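/- A temporal graph $\mathcal G=(G_1,\dots,G_T)$ is a finite sequence of graphs (snapshots) on a common vertex set $V$ with $|V|=n$. A temporal edge is a pair $(e,i)$ with $e\in E(G_i)$. For $i\in[T]$ the bag $F_i$ is the set of all $v\in V$ for which there are $p,q\in[T]$ with $p\le i\le q$, $\deg_{G_p}(v)\ge 1$ and $\deg_{G_q}(v)\ge 1$. For $x\ge 1$ let $\mathrm{vimw}[x]$ be the size of the $x$-th largest of the bags $F_1,\dots,F_T$ (counted with multiplicity), and $\mathrm{vimw}[x]=0$ if $x>T$. A $k$-activity $\ell$-timeline is a set $\mathcal T$ of triples $(v,a,b)\in V\times[T]\times[T]$ with $a\le b$ and $b-a\le\ell$ that contains at most $k$ triples for each vertex $v$. It covers the temporal edge $(e,i)$ if there are an endpoint $v$ of $e$ and $(v,a,b)\in\mathcal T$ with $a\le i\le b$. The input of Timeline Partial Vertex Cover (Timeline PVC) is a temporal graph $\mathcal G$ with integers $k\ge 1$, $\ell\ge 0$, $t\ge 0$; the question is whether some $k$-activity $\ell$-timeline covers at least $t$ temporal edges of $\mathcal G$. **Proposition.** Timeline PVC is solvable in time $$\big((k+1)(\ell+2)\big)^{4\cdot\mathrm{vimw}[x]}\cdot(n+T)^{O(1)},\qquad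 x=k(\ell+1)+1.$$ That is, there are a single random access machine program (addition and truncated subtraction, direct and indirect addressing, uniform cost measure) and constants $C,c$ such that on every instance, given by $n,T,k,\ell,t$ and the adjacency matrices of the snapshots, the program halts with the correct answer after at most $C\cdot\big((k+1)(\ell+2)\big)^{4\cdot\mathrm{vimw}[x]}\cdot(n+T+1)^{c}$ steps. -/

import Mathlib

/-! Temporal graphs, bags, timelines and the decision problem Timeline Partial Vertex Cover. -/

/-- A temporal graph with lifetime `T` on the vertex set `V`: a sequence of `T` graphs on `V`.
Time steps are indexed by `0, …, T - 1` instead of `1, …, T`. -/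
abbrev TemporalGraph (V : Type*) (T : ℕ) := Fin T → SimpleGraph V

namespace TemporalGraph

variable {V : Type*} {T : ℕ}

/-- The temporal edges `(e, i)`, where `e` is an edge of the `i`-th snapshot. -/
def temporalEdges (G : TemporalGraph V T) : Set (Sym2 V × Fin T) :=
  {p | p.1 ∈ (G p.2).edgeSet}

open Classical in
/-- The bag of time step `i` in the vertex-interval-membership sequence: the vertices that have
degree at least one in some snapshot `p ≤ i` and in some snapshot `q ≥ i`. -/
noncomputable def bag [Fintype V] (G : TemporalGraph V T) (i : Fin T) : Finset V :=
  {v | ∃ p q : Fin T, p ≤ i ∧ i ≤ q ∧ 1 ≤ (G p).degree v ∧ 1 ≤ (G q).degree v}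

/-- The sizes of all `T` bags (with multiplicity), in non-increasing order. -/
noncomputable def sortedBagSizes [Fintype V] (G : TemporalGraph V T) : List ℕ :=
  (List.ofFn fun i => (G.bag i).card).mergeSort (fun a b => decide (b ≤ a))

/-- `vimw[x]` for `x ≥ 1`: the size of the `x`-th largest bag; it is `0` if `x > T`, when there are
fewer than `x` bags. -/
noncomputable def vimw [Fintype V] (G : TemporalGraph V T) (x : ℕ) : ℕ :=
  G.sortedBagSizes.getD (x - 1) 0

/-- A `k`-activity `ℓ`-timeline: a set of activity intervals `(v, a, b)` with `a ≤ b` and length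
`b - a` at most `ℓ`, containing at most `k` activity intervals of each vertex. -/
structure IsTimeline [DecidableEq V] (k ℓ : ℕ) (𝒯 : Finset (V × Fin T × Fin T)) : Prop where
  start_le_end : ∀ v a b, (v, a, b) ∈ 𝒯 → a ≤ b
  length_le : ∀ v a b, (v, a, b) ∈ 𝒯 → (b : ℕ) - (a : ℕ) ≤ ℓ
  card_le : ∀ v, {I ∈ 𝒯 | I.1 = v}.card ≤ k

/-- Vertex `v` is active in the `i`-th snapshot. -/
def IsActive (𝒯 : Finset (V × Fin T × Fin T)) (v : V) (i : Fin T) : Prop :=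
  ∃ a b, (v, a, b) ∈ 𝒯 ∧ a ≤ i ∧ i ≤ b

/-- The temporal edges of `G` that are covered by `𝒯`: some endpoint of `e` is active in the
`i`-th snapshot. -/
def coveredEdges (G : TemporalGraph V T) (𝒯 : Finset (V × Fin T × Fin T)) :
    Set (Sym2 V × Fin T) :=
  {p ∈ G.temporalEdges | ∃ v ∈ p.1, IsActive 𝒯 v p.2}

end TemporalGraph

/-- An instance of Timeline Partial Vertex Cover. The vertices are numbered `0, …, n - 1`. -/
structure TimelinePVC where
  n : ℕ
  T : ℕ
  graph : TemporalGraph (Fin n) T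
  k : ℕ
  one_le_k : 1 ≤ k
  ℓ : ℕ
  t : ℕ

/-- `I` is a yes-instance: some `k`-activity `ℓ`-timeline covers at least `t` temporal edges. -/
def TimelinePVC.IsYes (I : TimelinePVC) : Prop :=
  ∃ 𝒯 : Finset (Fin I.n × Fin I.T × Fin I.T),
    TemporalGraph.IsTimeline I.k I.ℓ 𝒯 ∧ I.t ≤ (I.graph.coveredEdges 𝒯).ncard

/-! The machine model: a random access machine with addition and (truncated) subtraction as its
only arithmetic operations, under the uniform cost measure. -/

namespace RAM

/-- A state: registers (a program mentions only finitely many of them) and a memory. -/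
structure State where
  reg : ℕ → ℕ
  mem : ℕ → ℕ

/-- Programs. Register names are constants of the program text; memory is addressed indirectly. -/
inductive Prog where
  /-- do nothing -/
  | skip : Prog
  /-- `R_d := c` -/
  | const (d c : ℕ) : Prog
  /-- `R_d := R_a + R_b` -/
  | add (d a b : ℕ) : Prog
  /-- `R_d := R_a - R_b`, which is `0` if `R_a < R_b` -/
  | sub (d a b : ℕ) : Prog
  /-- `R_d := M[R_a]` -/
  | load (d a : ℕ) : Prog
  /-- `M[R_a] := R_b` -/
  | store (a b : ℕ) : Prog
  /-- `p; q` -/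
  | seq (p q : Prog) : Prog
  /-- `if R_a ≠ 0 then p else q` -/
  | ite (a : ℕ) (p q : Prog) : Prog
  /-- `while R_a ≠ 0 do p` -/
  | while (a : ℕ) (p : Prog) : Prog

/-- `Exec p s s' τ`: started in state `s`, the program `p` halts in state `s'` after `τ` steps.
Each elementary instruction and each evaluation of a test is one step. -/
inductive Exec : Prog → State → State → ℕ → Prop where
  | skip (s : State) : Exec .skip s s 1
  | const (d c : ℕ) (s : State) :
      Exec (.const d c) s { s with reg := Function.update s.reg d c } 1
  | add (d a b : ℕ) (s : State) :
      Exec (.add d a b) s { s with reg := Function.update s.reg d (s.reg a + s.reg b) } 1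
  | sub (d a b : ℕ) (s : State) :
      Exec (.sub d a b) s { s with reg := Function.update s.reg d (s.reg a - s.reg b) } 1
  | load (d a : ℕ) (s : State) :
      Exec (.load d a) s { s with reg := Function.update s.reg d (s.mem (s.reg a)) } 1
  | store (a b : ℕ) (s : State) :
      Exec (.store a b) s { s with mem := Function.update s.mem (s.reg a) (s.reg b) } 1
  | seq {p q : Prog} {s s' s'' : State} {τ τ' : ℕ} :
      Exec p s s' τ → Exec q s' s'' τ' → Exec (.seq p q) s s'' (τ + τ')
  | ite_true {a : ℕ} {p q : Prog} {s s' : State} {τ : ℕ} :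
      s.reg a ≠ 0 → Exec p s s' τ → Exec (.ite a p q) s s' (τ + 1)
  | ite_false {a : ℕ} {p q : Prog} {s s' : State} {τ : ℕ} :
      s.reg a = 0 → Exec q s s' τ → Exec (.ite a p q) s s' (τ + 1)
  | while_true {a : ℕ} {p : Prog} {s s' s'' : State} {τ τ' : ℕ} :
      s.reg a ≠ 0 → Exec p s s' τ → Exec (.while a p) s' s'' τ' →
        Exec (.while a p) s s'' (τ + τ' + 1)
  | while_false {a : ℕ} {p : Prog} {s : State} :
      s.reg a = 0 → Exec (.while a p) s s 1

/-- Started in state `s`, the program `p` halts after at most `bound` steps, with `1` in register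
`0` if `answer` holds and with `0` in register `0` otherwise. -/
def DecidesInTime (p : Prog) (s : State) (answer : Prop) (bound : ℕ) : Prop :=
  ∃ (s' : State) (τ : ℕ), Exec p s s' τ ∧ τ ≤ bound ∧
    (answer → s'.reg 0 = 1) ∧ (¬ answer → s'.reg 0 = 0)

end RAM

open Classical in
/-- The initial state for input `I`: `n, T, k, ℓ, t` are in the registers `0, …, 4`, the adjacency
matrices of the snapshots are stored row by row, one after the other, in the memory from address
`0` on, and everything else is `0`. -/
noncomputable def TimelinePVC.initialState (I : TimelinePVC) : RAM.State where
  reg j := [I.n, I.T, I.k, I.ℓ, I.t].getD j 0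
  mem m := if ∃ (i : Fin I.T) (u v : Fin I.n),
      m = ((i : ℕ) * I.n + (u : ℕ)) * I.n + (v : ℕ) ∧ (I.graph i).Adj u v then 1 else 0

/-! The algorithm is a dynamic program over the boundaries between consecutive time steps. Let the
lifetime `[f v, e v]` of a vertex run from its first to its last incident temporal edge. If it has
at most `k(ℓ+1)` time steps, `k` consecutive intervals cover all of it, so `v` may be taken as
always active and nothing about it is stored. A vertex with a longer lifetime is stored at the
boundaries strictly inside this lifetime, by its number of unused intervals (`k+1` values) and the
remaining active steps of its current interval (`ℓ+1` values).

The parameter enters through `TemporalGraph.card_le_two_mul_vimw`: at most `2·vimw[x]` vertices are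
stored at a boundary. Let `A` be the set of stored vertices and `h = ⌈|A|/2⌉`. The vertices of `A`
that reach back to a bag of size less than `h` all lie in the nearest such bag on the left, so there
are at most `h-1` of them; likewise on the right. As `|A| > 2(h-1)`, some vertex of `A` reaches
neither, and its lifetime yields `x` bags of size at least `h`. Hence a boundary has at most
`((k+1)(ℓ+2))^(2·vimw[x])` states (`LifetimesRecorded.states_le`), and trying all pairs of states at
consecutive boundaries squares this.

Correctness is `Model.Lifetimes.le_value_iff`. A timeline may be replaced by its start times, each
interval having full length. A path of compatible states yields start times that cover at least as
much inside the lifetimes (`exists_value_le`); conversely, start times trace out such a path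
(`le_value`). Covered edges are counted as ordered pairs, so the value is compared with `2t`.

For the time bound the algorithm is written in a language of bounded loops with an exact cost
function and compiled to the machine (`Stmt.exec_comp`). Hoare-style triples `Spec` bound result and
cost together, and static write sets supply the frame conditions. States are numbered in a mixed
radix system, with radix 1 for vertices that are not stored, and are enumerated by incrementing
digits, without division. -/

/-! ### A language of bounded loops and its compilation to random access machine programs -/

/-- Variables of loop programs. The first five hold the parameters of the input. -/
inductive Var where
  | n | T | k | l | t
  | i | v | u | j | p | a | b
  | X | kc | lc | row | n2 | c | r | ok | g | best | Na | Nb | acc | carry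
  deriving DecidableEq

/-- Arrays of loop programs. -/
inductive Arr where
  | start | last | alive | alive' | rad | rad' | dig | dig' | act | val | new
  deriving DecidableEq

namespace Var

/-- The register that holds a variable. -/
def idx : Var → ℕ
  | n => 0 | T => 1 | k => 2 | l => 3 | t => 4
  | i => 5 | v => 6 | u => 7 | j => 8 | p => 10 | a => 11 | b => 12
  | X => 13 | kc => 14 | lc => 15 | row => 16 | n2 => 17 | c => 18 | r => 19 | ok => 20 | g => 21
  | best => 22 | Na => 23 | Nb => 24 | acc => 25 | carry => 26

theorem idx_lt (x : Var) : x.idx < 40 := by cases x <;> decide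

theorem idx_injective : Function.Injective idx := by
  intro x y h
  cases x <;> cases y <;> first | rfl | (exact absurd h (by decide))

end Var

namespace Arr

/-- The residue modulo `16` of the addresses used for an array. -/
def idx : Arr → ℕ
  | start => 0 | last => 1 | alive => 2 | alive' => 3 | rad => 4 | rad' => 5
  | dig => 6 | dig' => 7 | act => 8 | val => 9 | new => 10

theorem idx_lt (x : Arr) : x.idx < 16 := by cases x <;> decide

theorem idx_injective : Function.Injective idx := by
  intro x y h
  cases x <;> cases y <;> first | rfl | (exact absurd h (by decide))

end Arr

/-- States of loop programs: variables, unbounded arrays and a read-only input. -/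
structure Store where
  var : Var → ℕ
  arr : Arr → ℕ → ℕ
  inp : ℕ → ℕ

/-- Expressions. -/
inductive Expr where
  | const (c : ℕ)
  | var (x : Var)
  | add (e f : Expr)
  | sub (e f : Expr)
  | rd (A : Arr) (e : Expr)
  | inp (e : Expr)
  | cond (c e f : Expr)

namespace Expr

/-- The value of an expression. -/
def eval (h : Store) : Expr → ℕ
  | const c => c
  | var x => h.var x
  | add e f => e.eval h + f.eval h
  | sub e f => e.eval h - f.eval h
  | rd A e => h.arr A (e.eval h)
  | inp e => h.inp (e.eval h)
  | cond c e f => if c.eval h ≠ 0 then e.eval h else f.eval h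

/-- A bound for the time needed to evaluate an expression. -/
def size : Expr → ℕ
  | const _ => 1
  | var _ => 2
  | add e f => e.size + f.size + 1
  | sub e f => e.size + f.size + 1
  | rd _ e => e.size + 8
  | inp e => e.size + 3
  | cond c e f => c.size + (e.size + f.size) + 1

/-- Evaluation of an expression into register `d`, using only registers from `d` on. -/
def comp : Expr → ℕ → RAM.Prog
  | const c, d => .const d c
  | var x, d => .seq (.const d 0) (.add d x.idx d)
  | add e f, d => .seq (e.comp d) (.seq (f.comp (d + 1)) (.add d d (d + 1)))
  | sub e f, d => .seq (e.comp d) (.seq (f.comp (d + 1)) (.sub d d (d + 1)))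
  | rd A e, d => .seq (e.comp d) (.seq (.add d d d) (.seq (.add d d d) (.seq (.add d d d)
      (.seq (.add d d d) (.seq (.const (d + 1) A.idx) (.seq (.add d d (d + 1))
      (.seq (.add d d 40) (.load d d))))))))
  | inp e, d => .seq (e.comp d) (.seq (.sub (d + 1) 40 d) (.ite (d + 1) (.load d d) (.const d 0)))
  | cond c e f, d => .seq (c.comp d) (.ite d (e.comp d) (f.comp d))

/-- `1` if `e < f` and `0` otherwise. -/
abbrev lt (e f : Expr) : Expr := .cond (.sub f e) (.const 1) (.const 0)

/-- `1` if both conditions hold and `0` otherwise. -/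
abbrev and (e f : Expr) : Expr := .cond e (.cond f (.const 1) (.const 0)) (.const 0)

/-- `1` if `e = f` and `0` otherwise. -/
abbrev eq (e f : Expr) : Expr := .cond (.add (.sub e f) (.sub f e)) (.const 0) (.const 1)

end Expr

/-- Programs with bounded loops. -/
inductive Stmt where
  | asg (x : Var) (e : Expr)
  | sto (A : Arr) (e f : Expr)
  | seq (p q : Stmt)
  | ite (e : Expr) (p q : Stmt)
  | skip
  | rep (e : Expr) (p : Stmt)

namespace Store

/-- Assignment to a variable. -/
def setVar (h : Store) (x : Var) (m : ℕ) : Store := { h with var := Function.update h.var x m }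

/-- Assignment to an array cell. -/
def setArr (h : Store) (A : Arr) (m w : ℕ) : Store :=
  { h with arr := Function.update h.arr A (Function.update (h.arr A) m w) }

@[simp] theorem setVar_var (h : Store) (x y : Var) (m : ℕ) :
    (h.setVar x m).var y = if y = x then m else h.var y := by
  simp [setVar, Function.update_apply]

@[simp] theorem setVar_arr (h : Store) (x : Var) (m : ℕ) : (h.setVar x m).arr = h.arr := rfl

@[simp] theorem setVar_inp (h : Store) (x : Var) (m : ℕ) : (h.setVar x m).inp = h.inp := rfl

@[simp] theorem setArr_var (h : Store) (A : Arr) (m w : ℕ) : (h.setArr A m w).var = h.var := rfl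

@[simp] theorem setArr_inp (h : Store) (A : Arr) (m w : ℕ) : (h.setArr A m w).inp = h.inp := rfl

@[simp] theorem setArr_arr (h : Store) (A B : Arr) (m w j : ℕ) :
    (h.setArr A m w).arr B j = if B = A ∧ j = m then w else h.arr B j := by
  by_cases hB : B = A
  · subst hB; simp [setArr, Function.update_apply]
  · simp [setArr, hB]

end Store

namespace Stmt

/-- The final state of a program. -/
def run : Stmt → Store → Store
  | asg x e, h => h.setVar x (e.eval h)
  | sto A e f, h => h.setArr A (e.eval h) (f.eval h)
  | seq p q, h => q.run (p.run h)
  | ite e p q, h => if e.eval h ≠ 0 then p.run h else q.run h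
  | skip, h => h
  | rep e p, h => p.run^[e.eval h] h

/-- The running time of a program. -/
def cost : Stmt → Store → ℕ
  | asg _ e, _ => e.size + 2
  | sto _ e f, _ => e.size + f.size + 8
  | seq p q, h => p.cost h + q.cost (p.run h)
  | ite e p q, h => e.size + 1 + if e.eval h ≠ 0 then p.cost h else q.cost h
  | skip, _ => 1
  | rep e p, h => e.size + 1 + ∑ m ∈ Finset.range (e.eval h), (p.cost (p.run^[m] h) + 3)

/-- Compilation, using auxiliary registers from `d` on. -/
def comp : Stmt → ℕ → RAM.Prog
  | asg x e, d => .seq (e.comp d) (.seq (.const (d + 1) 0) (.add x.idx d (d + 1)))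
  | sto A e f, d => .seq (e.comp d) (.seq (f.comp (d + 1)) (.seq (.add d d d) (.seq (.add d d d)
      (.seq (.add d d d) (.seq (.add d d d) (.seq (.const (d + 2) A.idx) (.seq (.add d d (d + 2))
      (.seq (.add d d 40) (.store d (d + 1))))))))))
  | seq p q, d => .seq (p.comp d) (q.comp d)
  | ite e p q, d => .seq (e.comp d) (.ite d (p.comp d) (q.comp d))
  | skip, _ => .skip
  | rep e p, d => .seq (e.comp d)
      (.while d (.seq (p.comp (d + 1)) (.seq (.const (d + 1) 1) (.sub d d (d + 1)))))

end Stmt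

/-! ### Simulation of loop programs on the machine -/

/-- The machine state `s` represents `h`, with the input stored below address `base`. -/
structure Represents (base : ℕ) (s : RAM.State) (h : Store) : Prop where
  var : ∀ x : Var, s.reg x.idx = h.var x
  reg_base : s.reg 40 = base
  inp : ∀ m < base, s.mem m = h.inp m
  inp_zero : ∀ m, base ≤ m → h.inp m = 0
  arr : ∀ (A : Arr) (j : ℕ), s.mem (16 * j + A.idx + base) = h.arr A j

theorem Represents.congr {base : ℕ} {s s' : RAM.State} {h : Store} (H : Represents base s h)
    (hm : s'.mem = s.mem) (hr : ∀ m ≤ 40, s'.reg m = s.reg m) : Represents base s' h where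
  var x := by rw [hr _ x.idx_lt.le, H.var]
  reg_base := by rw [hr _ le_rfl, H.reg_base]
  inp m h := by rw [hm, H.inp m h]
  inp_zero := H.inp_zero
  arr A j := by rw [hm, H.arr]

open RAM in
-- A stack discipline: a second operand is evaluated from register `d + 1` on, so the first one
-- survives in `d`. Memory and all registers up to 40 stay intact, which keeps the store represented
-- during evaluation.
theorem Expr.exec_comp (e : Expr) {base : ℕ} {h : Store} :
    ∀ {s : State} (_ : Represents base s h) {d : ℕ} (_ : 40 < d),
      ∃ s' τ, Exec (e.comp d) s s' τ ∧ τ ≤ e.size ∧ s'.mem = s.mem ∧ s'.reg d = e.eval h ∧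
        ∀ m < d, s'.reg m = s.reg m := by
  induction e with
  | const c =>
    intro s _ d _
    refine ⟨_, _, .const d c s, le_rfl, rfl, by simp [eval], fun m hm => ?_⟩
    simp [hm.ne]
  | var x =>
    intro s H d hd
    refine ⟨_, _, .seq (.const ..) (.add ..), le_rfl, rfl, ?_, fun m hm => ?_⟩
    · have := x.idx_lt
      simp [eval, H.var, show x.idx ≠ d by omega]
    · simp [Function.update_apply, hm.ne]
  | add e f he hf =>
    intro s H d hd
    obtain ⟨s₁, τ₁, h₁, t₁, m₁, v₁, r₁⟩ := he H hd
    have H₁ := H.congr m₁ fun m hm => r₁ m (by omega)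
    obtain ⟨s₂, τ₂, h₂, t₂, m₂, v₂, r₂⟩ := hf H₁ (d := d + 1) (by omega)
    refine ⟨_, _, .seq h₁ (.seq h₂ (.add ..)), by simp only [size]; omega, m₂.trans m₁, ?_,
      fun m hm => ?_⟩
    · simp [eval, v₂, r₂ d (by omega), v₁]
    · simp [hm.ne, r₂ m (by omega), r₁ m hm]
  | sub e f he hf =>
    intro s H d hd
    obtain ⟨s₁, τ₁, h₁, t₁, m₁, v₁, r₁⟩ := he H hd
    have H₁ := H.congr m₁ fun m hm => r₁ m (by omega)
    obtain ⟨s₂, τ₂, h₂, t₂, m₂, v₂, r₂⟩ := hf H₁ (d := d + 1) (by omega)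
    refine ⟨_, _, .seq h₁ (.seq h₂ (.sub ..)), by simp only [size]; omega, m₂.trans m₁, ?_,
      fun m hm => ?_⟩
    · simp [eval, v₂, r₂ d (by omega), v₁]
    · simp [hm.ne, r₂ m (by omega), r₁ m hm]
  | rd A e he =>
    intro s H d hd
    obtain ⟨s₁, τ₁, h₁, t₁, m₁, v₁, r₁⟩ := he H hd
    refine ⟨_, _, .seq h₁ (.seq (.add ..) (.seq (.add ..) (.seq (.add ..) (.seq (.add ..)
      (.seq (.const ..) (.seq (.add ..) (.seq (.add ..) (.load ..)))))))),
      by simp only [size]; omega, m₁, ?_, fun m hm => ?_⟩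
    · simp only [eval, ← H.arr, m₁, Function.update_apply, v₁, if_true, Nat.succ_ne_self, if_false,
        (Nat.succ_ne_self d).symm, show 40 ≠ d by omega, show 40 ≠ d + 1 by omega,
        show s₁.reg 40 = base by rw [r₁ 40 hd, H.reg_base]]
      -- Four doublings have multiplied the index by 16.
      congr 1
      ring
    · simp [Function.update_apply, hm.ne, show m ≠ d + 1 by omega, r₁ m hm]
  | inp e he =>
    intro s H d hd
    obtain ⟨s₁, τ₁, h₁, t₁, m₁, v₁, r₁⟩ := he H hd
    have hb : s₁.reg 40 = base := by rw [r₁ 40 hd, H.reg_base]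
    -- Array cells occupy the addresses from `base` on, so a read beyond the input must not reach
    -- the memory and gives 0.
    by_cases hlt : e.eval h < base
    · refine ⟨_, _, .seq h₁ (.seq (.sub ..) (.ite_true ?_ (.load ..))),
        by simp only [size]; omega, m₁, ?_, fun m hm => ?_⟩
      · simp [hb, v₁]; omega
      · simp [eval, v₁, m₁, H.inp _ hlt]
      · simp [hm.ne, show m ≠ d + 1 by omega, r₁ m hm]
    · refine ⟨_, _, .seq h₁ (.seq (.sub ..) (.ite_false ?_ (.const ..))),
        by simp only [size]; omega, m₁, ?_, fun m hm => ?_⟩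
      · simp [hb, v₁]; omega
      · simp [eval, H.inp_zero _ (not_lt.1 hlt)]
      · simp [hm.ne, show m ≠ d + 1 by omega, r₁ m hm]
  | cond c e f hc he hf =>
    intro s H d hd
    obtain ⟨s₁, τ₁, h₁, t₁, m₁, v₁, r₁⟩ := hc H hd
    have H₁ := H.congr m₁ fun m hm => r₁ m (by omega)
    by_cases hz : c.eval h = 0
    · obtain ⟨s₂, τ₂, h₂, t₂, m₂, v₂, r₂⟩ := hf H₁ hd
      exact ⟨_, _, .seq h₁ (.ite_false (v₁.trans hz) h₂), by simp only [size]; omega,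
        m₂.trans m₁, by simp [eval, hz, v₂], fun m hm => (r₂ m hm).trans (r₁ m hm)⟩
    · obtain ⟨s₂, τ₂, h₂, t₂, m₂, v₂, r₂⟩ := he H₁ hd
      exact ⟨_, _, .seq h₁ (.ite_true (by rwa [v₁]) h₂), by simp only [size]; omega,
        m₂.trans m₁, by simp [eval, hz, v₂], fun m hm => (r₂ m hm).trans (r₁ m hm)⟩

open RAM in
-- Registers between 40 and `d` hold the counters of enclosing loops and have to survive; the body
-- of a loop with counter `d` is compiled from `d + 1` on.
theorem Stmt.exec_comp (p : Stmt) {base : ℕ} :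
    ∀ {h : Store} {s : State} (_ : Represents base s h) {d : ℕ} (_ : 40 < d),
      ∃ s' τ, Exec (p.comp d) s s' τ ∧ τ ≤ p.cost h ∧ Represents base s' (p.run h) ∧
        ∀ m, 40 < m → m < d → s'.reg m = s.reg m := by
  induction p with
  | asg x e =>
    intro h s H d hd
    obtain ⟨s₁, τ₁, h₁, t₁, m₁, v₁, r₁⟩ := e.exec_comp H hd
    have hx := x.idx_lt
    refine ⟨_, _, .seq h₁ (.seq (.const ..) (.add ..)), by simp only [cost]; omega, ?_,
      fun m hm hd => ?_⟩
    · constructor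
      · intro y
        have hy := y.idx_lt
        by_cases hxy : y = x
        · subst hxy; simp [run, v₁]
        · simp [run, hxy, Var.idx_injective.eq_iff,
            show y.idx ≠ d + 1 by omega, r₁ y.idx (by omega), H.var]
      · simp [show 40 ≠ x.idx by omega, show 40 ≠ d + 1 by omega, r₁ 40 hd,
          H.reg_base]
      · intro m hm; simp [run, m₁, H.inp m hm]
      · exact H.inp_zero
      · intro A j; simp [run, m₁, H.arr]
    · simp [show m ≠ x.idx by omega, show m ≠ d + 1 by omega, r₁ m hd]
  | sto A e f =>
    intro h s H d hd
    obtain ⟨s₁, τ₁, h₁, t₁, m₁, v₁, r₁⟩ := e.exec_comp H hd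
    have H₁ := H.congr m₁ fun m hm => r₁ m (by omega)
    obtain ⟨s₂, τ₂, h₂, t₂, m₂, v₂, r₂⟩ := f.exec_comp H₁ (d := d + 1) (by omega)
    refine ⟨_, _, .seq h₁ (.seq h₂ (.seq (.add ..) (.seq (.add ..) (.seq (.add ..) (.seq (.add ..)
      (.seq (.const ..) (.seq (.add ..) (.seq (.add ..) (.store ..))))))))),
      by simp only [cost]; omega, ?_, fun m hm hd => ?_⟩
    · have hb : s₂.reg 40 = base := by rw [r₂ 40 (by omega), r₁ 40 hd, H.reg_base]
      have hA := A.idx_lt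
      constructor
      · intro y
        have hy := y.idx_lt
        simp [run, Function.update_apply, show y.idx ≠ d by omega, show y.idx ≠ d + 2 by omega,
          r₂ y.idx (by omega), r₁ y.idx (by omega), H.var]
      · simp [show 40 ≠ d by omega, show 40 ≠ d + 2 by omega, hb]
      · intro m hm
        simp only [run, Store.setArr_inp, Function.update_apply, if_true, hb, m₂, m₁,
          show 40 ≠ d by omega, show 40 ≠ d + 2 by omega, if_false]
        rw [if_neg (by omega), H.inp m hm]
      · exact H.inp_zero
      · intro B j
        have hB := B.idx_lt
        simp only [run, Store.setArr_arr, Function.update_apply, if_true, hb, m₂, m₁, v₂,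
          r₂ d (by omega), v₁, show d ≠ d + 2 by omega, show d + 2 ≠ d by omega,
          show d + 1 ≠ d by omega, show d + 1 ≠ d + 2 by omega,
          show 40 ≠ d by omega, show 40 ≠ d + 2 by omega, if_false, H.arr]
        -- Distinct array cells have distinct addresses, because the residues of the arrays modulo
        -- 16 are distinct.
        refine if_congr ?_ rfl rfl
        rw [← Arr.idx_injective.eq_iff]
        omega
    · simp [Function.update_apply, show m ≠ d by omega, show m ≠ d + 2 by omega,
        r₂ m (by omega), r₁ m hd]
  | seq p q hp hq =>
    intro h s H d hd
    obtain ⟨s₁, τ₁, h₁, t₁, H₁, r₁⟩ := hp H hd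
    obtain ⟨s₂, τ₂, h₂, t₂, H₂, r₂⟩ := hq H₁ hd
    exact ⟨_, _, .seq h₁ h₂, by simp only [cost]; omega, H₂,
      fun m hm hd => (r₂ m hm hd).trans (r₁ m hm hd)⟩
  | ite e p q hp hq =>
    intro h s H d hd
    obtain ⟨s₁, τ₁, h₁, t₁, m₁, v₁, r₁⟩ := e.exec_comp H hd
    have H₁ := H.congr m₁ fun m hm => r₁ m (by omega)
    by_cases hz : e.eval h = 0
    · obtain ⟨s₂, τ₂, h₂, t₂, H₂, r₂⟩ := hq H₁ hd
      exact ⟨_, _, .seq h₁ (.ite_false (v₁.trans hz) h₂), by simp only [cost, hz]; simp; omega,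
        by simpa [run, hz] using H₂, fun m hm hd => (r₂ m hm hd).trans (r₁ m hd)⟩
    · obtain ⟨s₂, τ₂, h₂, t₂, H₂, r₂⟩ := hp H₁ hd
      exact ⟨_, _, .seq h₁ (.ite_true (by rwa [v₁]) h₂), by simp only [cost, if_pos hz]; omega,
        by simpa [run, hz] using H₂, fun m hm hd => (r₂ m hm hd).trans (r₁ m hd)⟩
  | skip =>
    intro h s H d hd
    exact ⟨_, _, .skip s, le_rfl, H, fun _ _ _ => rfl⟩
  | rep e p hp =>
    intro h s H d hd
    obtain ⟨s₁, τ₁, h₁, t₁, m₁, v₁, r₁⟩ := e.exec_comp H hd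
    have H₁ := H.congr m₁ fun m hm => r₁ m (by omega)
    -- Induction on the counter. The 3 extra steps per round are the test, the constant and the
    -- decrement.
    suffices hw : ∀ (N : ℕ) (h : Store) (s : State), Represents base s h → s.reg d = N →
        ∃ s' τ, Exec (.while d (.seq (p.comp (d + 1)) (.seq (.const (d + 1) 1)
          (.sub d d (d + 1))))) s s' τ ∧
          τ ≤ 1 + ∑ m ∈ Finset.range N, (p.cost (p.run^[m] h) + 3) ∧
          Represents base s' (p.run^[N] h) ∧ ∀ m, 40 < m → m < d → s'.reg m = s.reg m by
      obtain ⟨s₂, τ₂, h₂, t₂, H₂, r₂⟩ := hw _ _ _ H₁ v₁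
      exact ⟨_, _, .seq h₁ h₂, by simp only [cost]; omega, H₂,
        fun m hm hd => (r₂ m hm hd).trans (r₁ m hd)⟩
    clear H₁ r₁ v₁ m₁ h₁ t₁ s₁ τ₁ H h s
    intro N
    induction N with
    | zero => exact fun h s H hz => ⟨s, 1, .while_false hz, by simp, H, fun _ _ _ => rfl⟩
    | succ N ih =>
      intro h s H hz
      obtain ⟨s₁, τ₁, h₁, t₁, H₁, r₁⟩ := hp H (d := d + 1) (by omega)
      have e₁ := (h₁.seq (.seq (.const (d + 1) 1 _) (.sub d d (d + 1) _)))
      set s₂ : State := ⟨Function.update (Function.update s₁.reg (d + 1) 1) d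
        (Function.update s₁.reg (d + 1) 1 d - Function.update s₁.reg (d + 1) 1 (d + 1)), s₁.mem⟩
      have hs₂ : ∀ m, m < d → s₂.reg m = s₁.reg m := fun m hm => by
        simp [s₂, hm.ne, show m ≠ d + 1 by omega]
      obtain ⟨s₃, τ₃, h₃, t₃, H₃, r₃⟩ := ih (p.run h) s₂
        (H₁.congr rfl fun m hm => hs₂ m (by omega))
        (by simp [s₂, r₁ d hd (by omega), hz])
      refine ⟨_, _, .while_true (by omega) e₁ h₃, ?_, H₃, fun m hm hd' => ?_⟩
      · rw [Finset.sum_range_succ']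
        simp only [Function.iterate_succ, Function.comp, Function.iterate_zero, id]
        omega
      · rw [r₃ m hm hd', hs₂ m hd', r₁ m hm (by omega)]

/-! ### Hoare-style specifications with frames and running times -/

namespace Stmt

/-- Whether a program assigns to a variable. -/
def writesVar (x : Var) : Stmt → Bool
  | asg y _ => decide (x = y)
  | sto _ _ _ => false
  | seq p q => p.writesVar x || q.writesVar x
  | ite _ p q => p.writesVar x || q.writesVar x
  | skip => false
  | rep _ p => p.writesVar x

/-- Whether a program assigns to cells of an array. -/
def writesArr (A : Arr) : Stmt → Bool
  | asg _ _ => false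
  | sto B _ _ => decide (A = B)
  | seq p q => p.writesArr A || q.writesArr A
  | ite _ p q => p.writesArr A || q.writesArr A
  | skip => false
  | rep _ p => p.writesArr A

/-- `h` and `h'` only differ in places where `p` may write. -/
structure Frame (p : Stmt) (h h' : Store) : Prop where
  var : ∀ x, p.writesVar x = false → h'.var x = h.var x
  arr : ∀ A, p.writesArr A = false → h'.arr A = h.arr A
  inp : h'.inp = h.inp

theorem Frame.refl (p : Stmt) (h : Store) : Frame p h h :=
  ⟨fun _ _ => rfl, fun _ _ => rfl, rfl⟩

theorem Frame.trans {p : Stmt} {h₁ h₂ h₃ : Store} (F : Frame p h₁ h₂) (F' : Frame p h₂ h₃) :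
    Frame p h₁ h₃ :=
  ⟨fun x hx => (F'.var x hx).trans (F.var x hx), fun A hA => (F'.arr A hA).trans (F.arr A hA),
    F'.inp.trans F.inp⟩

theorem frame_iterate {p : Stmt} (hp : ∀ h, Frame p h (p.run h)) (N : ℕ) (h : Store) :
    Frame p h (p.run^[N] h) := by
  induction N with
  | zero => exact .refl p h
  | succ N ih => rw [Function.iterate_succ_apply']; exact ih.trans (hp _)

theorem frame (p : Stmt) (h : Store) : Frame p h (p.run h) := by
  induction p generalizing h with
  | asg y e =>
    refine ⟨fun x hx => ?_, fun _ _ => rfl, rfl⟩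
    have : x ≠ y := by simpa [writesVar] using hx
    simp [run, this]
  | sto B e f =>
    refine ⟨fun _ _ => rfl, fun A hA => ?_, rfl⟩
    have : A ≠ B := by simpa [writesArr] using hA
    funext j
    simp [run, this]
  | seq p q hp hq =>
    refine ⟨fun x hx => ?_, fun A hA => ?_, (hq _).inp.trans (hp _).inp⟩
    · simp only [writesVar, Bool.or_eq_false_iff] at hx
      exact ((hq _).var x hx.2).trans ((hp _).var x hx.1)
    · simp only [writesArr, Bool.or_eq_false_iff] at hA
      exact ((hq _).arr A hA.2).trans ((hp _).arr A hA.1)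
  | ite e p q hp hq =>
    refine ⟨fun x hx => ?_, fun A hA => ?_, ?_⟩
    · simp only [writesVar, Bool.or_eq_false_iff] at hx
      unfold run
      split_ifs
      exacts [(hp h).var x hx.1, (hq h).var x hx.2]
    · simp only [writesArr, Bool.or_eq_false_iff] at hA
      unfold run
      split_ifs
      exacts [(hp h).arr A hA.1, (hq h).arr A hA.2]
    · unfold run
      split_ifs
      exacts [(hp h).inp, (hq h).inp]
  | skip => exact .refl _ h
  | rep e p hp =>
    have := frame_iterate hp (e.eval h) h
    exact ⟨this.var, this.arr, this.inp⟩

/-- Started in `h`, the program `p` reaches a state with property `Q` within `b` steps. -/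
def Spec (p : Stmt) (h : Store) (b : ℕ) (Q : Store → Prop) : Prop := Q (p.run h) ∧ p.cost h ≤ b

/-- The frame is available when a postcondition is weakened, so postconditions need only mention
what a program changes. -/
theorem Spec.mono {p : Stmt} {h : Store} {b b' : ℕ} {Q Q' : Store → Prop} (H : p.Spec h b Q)
    (hb : b ≤ b') (hQ : ∀ h', Frame p h h' → Q h' → Q' h') : p.Spec h b' Q' :=
  ⟨hQ _ (frame p h) H.1, H.2.trans hb⟩

theorem Spec.seq {p q : Stmt} {h : Store} {b b' : ℕ} {Q Q' : Store → Prop} (H : p.Spec h b Q)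
    (H' : ∀ h', Frame p h h' → Q h' → q.Spec h' b' Q') : (p.seq q).Spec h (b + b') Q' :=
  have := H' _ (frame p h) H.1
  ⟨this.1, add_le_add H.2 this.2⟩

theorem spec_asg {x : Var} {e : Expr} {h : Store} {Q : Store → Prop}
    (H : Q (h.setVar x (e.eval h))) : (asg x e).Spec h (e.size + 2) Q := ⟨H, le_rfl⟩

theorem spec_sto {A : Arr} {e f : Expr} {h : Store} {Q : Store → Prop}
    (H : Q (h.setArr A (e.eval h) (f.eval h))) : (sto A e f).Spec h (e.size + f.size + 8) Q :=
  ⟨H, le_rfl⟩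

theorem spec_skip {h : Store} {Q : Store → Prop} (H : Q h) : skip.Spec h 1 Q := ⟨H, le_rfl⟩

theorem spec_ite {e : Expr} {p q : Stmt} {h : Store} {b b' : ℕ} {Q : Store → Prop}
    (Hp : e.eval h ≠ 0 → p.Spec h b Q) (Hq : e.eval h = 0 → q.Spec h b' Q) :
    (ite e p q).Spec h (e.size + 1 + (b + b')) Q := by
  unfold Spec run cost
  by_cases hz : e.eval h = 0
  · rw [if_neg (not_not.2 hz), if_neg (not_not.2 hz)]
    exact ⟨(Hq hz).1, by have := (Hq hz).2; omega⟩
  · rw [if_pos hz, if_pos hz]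
    exact ⟨(Hp hz).1, by have := (Hp hz).2; omega⟩

theorem spec_rep {e : Expr} {p : Stmt} {h : Store} {N b : ℕ} (hN : e.eval h = N)
    (I : ℕ → Store → Prop) (h0 : I 0 h)
    (step : ∀ m < N, ∀ h', Frame p h h' → I m h' → p.Spec h' b (I (m + 1))) :
    (rep e p).Spec h (e.size + 1 + N * (b + 3)) (I N) := by
  have key : ∀ m ≤ N, I m (p.run^[m] h) := by
    intro m
    induction m with
    | zero => exact fun _ => h0
    | succ m ih =>
      intro hm
      rw [Function.iterate_succ_apply']
      exact (step m hm _ (frame_iterate (frame p) m h) (ih (by omega))).1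
  unfold Spec run cost
  rw [hN]
  refine ⟨key N le_rfl, Nat.add_le_add_left ?_ _⟩
  refine (Finset.sum_le_card_nsmul _ _ (b + 3) fun m hm => ?_).trans (by simp)
  rw [Finset.mem_range] at hm
  exact Nat.add_le_add_right (step m hm _ (frame_iterate (frame p) m h) (key m hm.le)).2 3

/-- The loop in which `x` runs through `0, …, e - 1`. -/
def loop (x : Var) (e : Expr) (p : Stmt) : Stmt :=
  .seq (.asg x (.const 0)) (.rep e (.seq p (.asg x (.add (.var x) (.const 1)))))

/-- Since the body does not assign `x`, the value of `x` is the number of completed rounds. The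
invariant is demanded after the increment, hence the `setVar` in the postcondition of the body. -/
theorem spec_loop {x : Var} {e : Expr} {p : Stmt} {h : Store} {N b : ℕ}
    (hx : p.writesVar x = false) (hN : e.eval (h.setVar x 0) = N)
    (I : ℕ → Store → Prop) (h0 : I 0 (h.setVar x 0))
    (step : ∀ m < N, ∀ h', Frame (Stmt.loop x e p) h h' → h'.var x = m → I m h' →
      p.Spec h' b fun h'' => I (m + 1) (h''.setVar x (m + 1))) :
    (Stmt.loop x e p).Spec h (e.size + 4 + N * (b + 9)) (I N) := by
  have F₀ : Frame (Stmt.loop x e p) h (h.setVar x 0) := by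
    refine ⟨fun y hy => ?_, fun _ _ => rfl, rfl⟩
    simp only [Stmt.loop, writesVar, Bool.or_eq_false_iff] at hy
    have : y ≠ x := by simpa using hy.1
    simp [this]
  refine Spec.mono (Spec.seq (Q := fun h' => h' = h.setVar x 0)
    (spec_asg (e := .const 0) rfl) ?_)
    (b := 3 + (e.size + 1 + N * (b + 6 + 3))) ?_ (fun _ _ h => h)
  · rintro _ - rfl
    refine (spec_rep hN (fun m h' => h'.var x = m ∧ I m h') ⟨by simp, h0⟩ ?_).mono le_rfl
      fun _ _ h => h.2
    rintro m hm h' F ⟨hxm, hI⟩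
    refine (Spec.seq (step m hm h' (F₀.trans ⟨fun y hy => F.var y ?_, fun A hA => F.arr A ?_, F.inp⟩)
      hxm hI) ?_).mono (b := b + 6) le_rfl fun _ _ h => h
    · simp only [Stmt.loop, writesVar, Bool.or_eq_false_iff] at hy ⊢
      exact hy.2
    · simpa [Stmt.loop, writesArr] using hA
    · intro h'' F' hI'
      refine spec_asg ?_
      have : h''.var x = m := (F'.var x hx).trans hxm
      simpa [Expr.eval, this] using hI'
  · have : N * (b + 6 + 3) = N * (b + 9) := rfl
    omega

/-- A program without loops. -/
def loopFree : Stmt → Bool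
  | asg _ _ => true
  | sto _ _ _ => true
  | seq p q => p.loopFree && q.loopFree
  | ite _ p q => p.loopFree && q.loopFree
  | skip => true
  | rep _ _ => false

/-- A bound for the running time of a program without loops. -/
def size : Stmt → ℕ
  | asg _ e => e.size + 2
  | sto _ e f => e.size + f.size + 8
  | seq p q => p.size + q.size
  | ite e p q => e.size + 1 + (p.size + q.size)
  | skip => 1
  | rep _ _ => 0

theorem cost_le_size {p : Stmt} (hp : p.loopFree = true) (h : Store) : p.cost h ≤ p.size := by
  induction p generalizing h with
  | asg | sto | skip => exact le_rfl
  | seq p q ihp ihq =>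
    simp only [loopFree, Bool.and_eq_true] at hp
    exact add_le_add (ihp hp.1 _) (ihq hp.2 _)
  | ite e p q ihp ihq =>
    simp only [loopFree, Bool.and_eq_true] at hp
    have h1 := ihp hp.1 h
    have h2 := ihq hp.2 h
    simp only [cost, size]
    split_ifs <;> omega
  | rep => simp [loopFree] at hp

/-- Loop-free code is executed symbolically: its cost is bounded by a syntactic number that
evaluates by computation, and only the final state needs an argument. -/
theorem spec_of_loopFree {p : Stmt} {h : Store} {Q : Store → Prop} {b : ℕ}
    (hp : p.loopFree = true) (hb : p.size ≤ b) (H : Q (p.run h)) : p.Spec h b Q :=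
  ⟨H, (cost_le_size hp h).trans hb⟩

end Stmt

/-! ### The input area -/

open RAM in
/-- `R_d := R_a * R_b`, with the auxiliary register `c` and with `1` in register `o`. -/
def mulProg (d a b c o : ℕ) : Prog :=
  .seq (.const o 1) (.seq (.const d 0) (.seq (.const c 0) (.seq (.add c a c)
    (.while c (.seq (.add d d b) (.sub c c o))))))

open RAM in
-- Repeated addition, hence time linear in the first factor; it serves to compute the length of the
-- input area.
theorem exec_mulProg {d a b c o : ℕ} (had : a ≠ d) (hac : a ≠ c) (hao : a ≠ o) (hbd : b ≠ d)
    (hbc : b ≠ c) (hbo : b ≠ o) (hdc : d ≠ c) (hdo : d ≠ o) (hco : c ≠ o) (s : State) :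
    ∃ s' τ, Exec (mulProg d a b c o) s s' τ ∧ τ ≤ 5 + 3 * s.reg a ∧ s'.mem = s.mem ∧
      s'.reg d = s.reg a * s.reg b ∧ ∀ m, m ≠ d → m ≠ c → m ≠ o → s'.reg m = s.reg m := by
  have key : ∀ (N : ℕ) (s : State), s.reg c = N → s.reg o = 1 →
      ∃ s' τ, Exec (.while c (.seq (.add d d b) (.sub c c o))) s s' τ ∧ τ ≤ 1 + 3 * N ∧
        s'.mem = s.mem ∧ s'.reg d = s.reg d + N * s.reg b ∧
        ∀ m, m ≠ d → m ≠ c → m ≠ o → s'.reg m = s.reg m := by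
    intro N
    induction N with
    | zero => exact fun s hc _ => ⟨s, 1, .while_false hc, le_rfl, rfl, by simp, fun _ _ _ _ => rfl⟩
    | succ N ih =>
      intro s hc ho
      obtain ⟨s', τ, h', t', m', v', r'⟩ := ih
        ⟨Function.update (Function.update s.reg d (s.reg d + s.reg b)) c N, s.mem⟩
        (by simp) (by simp [hdo.symm, hco.symm, ho])
      have e₁ := (Exec.add d d b s).seq (.sub c c o _)
      simp only [Function.update_of_ne hdc.symm, Function.update_of_ne hdo.symm, hc, ho,
        Nat.add_sub_cancel] at e₁
      refine ⟨s', _, .while_true (by omega) e₁ h', by omega, m', ?_, fun m h1 h2 h3 => ?_⟩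
      · simp only [v', Function.update_of_ne hdc, Function.update_self, Function.update_of_ne hbc,
          Function.update_of_ne hbd]
        ring
      · simp [r' m h1 h2 h3, h1, h2]
  obtain ⟨s', τ, h', t', m', v', r'⟩ := key (s.reg a)
    ⟨Function.update (Function.update (Function.update (Function.update s.reg o 1) d 0) c 0) c
      (s.reg a), s.mem⟩ (by simp) (by simp [hco.symm, hdo.symm])
  refine ⟨s', 1 + (1 + (1 + (1 + τ))), ?_, by omega, m', ?_, fun m h1 h2 h3 => ?_⟩
  · refine .seq (.const ..) (.seq (.const ..) (.seq (.const ..) (.seq (.add ..) ?_)))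
    simpa [had, hac, hao] using h'
  · simp [v', hdc, hbc, hbd, hbo]
  · simp [r' m h1 h2 h3, h1, h2, h3]

/-! ### Mixed radix digits -/

/-- The digit `j` of `m` in the mixed radix system with radices `R`. -/
def mixedDigit (R : ℕ → ℕ) (m j : ℕ) : ℕ := m / (∏ x ∈ Finset.range j, R x) % R j

theorem mixedDigit_zero (R : ℕ → ℕ) (j : ℕ) : mixedDigit R 0 j = 0 := by simp [mixedDigit]

/-- Digits are attached at the most significant end: the summand for a new digit is a multiple of
the product of all lower radices and leaves the lower digits alone. -/
theorem exists_mixedDigit_eq (R d : ℕ → ℕ) (N : ℕ) (hd : ∀ j < N, d j < R j) :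
    ∃ m < ∏ x ∈ Finset.range N, R x, ∀ j < N, mixedDigit R m j = d j := by
  induction N with
  | zero => exact ⟨0, by simp, by simp⟩
  | succ N ih =>
    obtain ⟨m, hm, hj⟩ := ih fun j h => hd j (h.trans N.lt_succ_self)
    have hP : 0 < ∏ x ∈ Finset.range N, R x := Nat.zero_lt_of_lt hm
    refine ⟨m + (∏ x ∈ Finset.range N, R x) * d N, ?_, fun j h => ?_⟩
    · rw [Finset.prod_range_succ]
      have := Nat.mul_le_mul_left (∏ x ∈ Finset.range N, R x) (hd N N.lt_succ_self)
      rw [Nat.succ_eq_add_one, mul_add] at this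
      omega
    · rcases Nat.lt_succ_iff_lt_or_eq.1 h with h | rfl
      · rw [← hj j h]
        obtain ⟨c, hc⟩ := Finset.prod_dvd_prod_of_subset (Finset.range (j + 1)) (Finset.range N) R
          (Finset.range_subset_range.2 h)
        rw [Finset.prod_range_succ] at hc
        have hQ : 0 < ∏ x ∈ Finset.range j, R x := by
          rcases Nat.eq_zero_or_pos (∏ x ∈ Finset.range j, R x) with h0 | h0
          · rw [hc, h0] at hP; simp at hP
          · exact h0
        unfold mixedDigit
        rw [hc, mul_assoc, mul_assoc, Nat.add_mul_div_left _ _ hQ, Nat.add_mul_mod_self_left]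
      · unfold mixedDigit
        rw [Nat.add_mul_div_left _ _ hP, Nat.div_eq_of_lt hm, zero_add,
          Nat.mod_eq_of_lt (hd j h)]

/-- A carry reaches digit `j` exactly when the quotient by the product of the lower radices
increases, that is, when this product divides `m + 1`. -/
theorem mixedDigit_succ (R : ℕ → ℕ) (m j : ℕ) :
    mixedDigit R (m + 1) j =
      if (∏ x ∈ Finset.range j, R x) ∣ m + 1 then
        if mixedDigit R m j + 1 = R j then 0 else mixedDigit R m j + 1
      else mixedDigit R m j := by
  unfold mixedDigit
  rw [Nat.succ_div]
  split_ifs with h h'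
  · rw [Nat.add_mod, ← Nat.add_mod, ← Nat.mod_add_mod, h', Nat.mod_self]
  · rcases Nat.eq_zero_or_pos (R j) with h0 | h0
    · simp [h0]
    · rw [← Nat.mod_add_mod, Nat.mod_eq_of_lt]
      have := Nat.mod_lt (m / ∏ x ∈ Finset.range j, R x) h0
      omega
  · rfl

/-- The carry is passed on by digit `j` exactly when it arrives there and the digit overflows. -/
theorem prod_range_succ_dvd_iff (R : ℕ → ℕ) (m j : ℕ) (hP : 0 < ∏ x ∈ Finset.range j, R x)
    (hR : 0 < R j) :
    (∏ x ∈ Finset.range (j + 1), R x) ∣ m + 1 ↔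
      (∏ x ∈ Finset.range j, R x) ∣ m + 1 ∧ mixedDigit R m j + 1 = R j := by
  rw [Finset.prod_range_succ]
  constructor
  · intro h
    have h1 := (Dvd.intro _ rfl : (∏ x ∈ Finset.range j, R x) ∣ _).trans h
    refine ⟨h1, ?_⟩
    have h2 := Nat.div_dvd_div (Dvd.intro _ rfl) h
    rw [Nat.mul_div_cancel_left _ hP, Nat.succ_div, if_pos h1] at h2
    have h3 := Nat.mod_lt (m / ∏ x ∈ Finset.range j, R x) hR
    have h4 := (Nat.dvd_iff_mod_eq_zero ..).1 h2
    unfold mixedDigit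
    by_contra h5
    rw [← Nat.mod_add_mod, Nat.mod_eq_of_lt (by omega)] at h4
    omega
  · rintro ⟨h1, h2⟩
    obtain ⟨c, hc⟩ := h1
    rw [hc]
    refine mul_dvd_mul_left _ ?_
    have h3 : (m + 1) / (∏ x ∈ Finset.range j, R x) = c := by
      rw [hc, Nat.mul_div_cancel_left _ hP]
    rw [Nat.succ_div, if_pos ⟨c, hc⟩] at h3
    unfold mixedDigit at h2
    rw [← h3, Nat.dvd_iff_mod_eq_zero, ← Nat.mod_add_mod, h2, Nat.mod_self]

/-! ### The dynamic program -/

/-- The data of the dynamic program: vertices `0, …, n - 1`, time steps `0, …, T - 1`, the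
adjacency relations, and for each boundary `i`, the point in time just before time step `i`, the
vertices whose state at the boundary is stored. -/
structure Model where
  n : ℕ
  T : ℕ
  k : ℕ
  l : ℕ
  alive : ℕ → ℕ → Prop
  adj : ℕ → ℕ → ℕ → Prop

namespace Model

variable (M : Model)

open Classical in
/-- The radices of the states at boundary `i`: for every vertex first the number of remaining steps
of its current activity interval, and then the number of its activity intervals left. -/
noncomputable def radix (i j : ℕ) : ℕ :=
  if j < M.n then if M.alive i j then M.l + 1 else 1
  else if M.alive i (j - M.n) then M.k + 1 else 1

/-- The number of states at boundary `i`. -/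
noncomputable def states (i : ℕ) : ℕ := ∏ j ∈ Finset.range (M.n + M.n), M.radix i j

open Classical in
/-- The number of activity intervals that are left for `v` at boundary `i` in state `z`. -/
noncomputable def left (i : ℕ) (z : ℕ → ℕ) (v : ℕ) : ℕ := if M.alive i v then z (M.n + v) else M.k

open Classical in
/-- The number of remaining active time steps of `v` at boundary `i` in state `z`. -/
noncomputable def rem (i : ℕ) (z : ℕ → ℕ) (v : ℕ) : ℕ := if M.alive i v then z v else 0

/-- No activity interval of `v` starts at time `i`. -/
def Keep (i : ℕ) (z z' : ℕ → ℕ) (v : ℕ) : Prop :=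
  z' (M.n + v) = M.left i z v ∧ z' v = M.rem i z v - 1

/-- An activity interval of `v` starts at time `i`. -/
def Starts (i : ℕ) (z z' : ℕ → ℕ) (v : ℕ) : Prop :=
  M.left i z v = z' (M.n + v) + 1 ∧ z' v = M.l

/-- The states `z` at boundary `i` and `z'` at boundary `i + 1` are compatible. -/
def Compatible (i : ℕ) (z z' : ℕ → ℕ) : Prop :=
  ∀ v < M.n, M.alive (i + 1) v → M.Keep i z z' v ∨ M.Starts i z z' v

/-- Vertex `v` is active at time `i` between the states `z` and `z'`. -/
def Active (i : ℕ) (z z' : ℕ → ℕ) (v : ℕ) : Prop :=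
  (M.alive (i + 1) v ∧ (¬ M.Keep i z z' v ∨ M.rem i z v ≠ 0)) ∨
    (¬ M.alive (i + 1) v ∧ M.left i z v + M.rem i z v ≠ 0)

open Classical in
/-- The number of ordered pairs of vertices that are adjacent at time `i` and of which one
satisfies `A`. -/
noncomputable def gain (i : ℕ) (A : ℕ → Prop) : ℕ :=
  ∑ u ∈ Finset.range M.n, ∑ v ∈ Finset.range M.n, if M.adj i u v ∧ (A u ∨ A v) then 1 else 0

open Classical in
/-- The value of the state with number `m` at boundary `T - q`. -/
noncomputable def value : ℕ → ℕ → ℕ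
  | 0, _ => 0
  | q + 1, m => (Finset.range (M.states (M.T - (q + 1) + 1))).sup fun b =>
      if M.Compatible (M.T - (q + 1)) (mixedDigit (M.radix (M.T - (q + 1))) m)
          (mixedDigit (M.radix (M.T - (q + 1) + 1)) b) then
        value q b + M.gain (M.T - (q + 1)) (M.Active (M.T - (q + 1))
          (mixedDigit (M.radix (M.T - (q + 1))) m) (mixedDigit (M.radix (M.T - (q + 1) + 1)) b))
      else 0

theorem gain_mono {i : ℕ} {A B : ℕ → Prop}
    (h : ∀ u < M.n, ∀ v < M.n, M.adj i u v → A u ∨ A v → B u ∨ B v) :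
    M.gain i A ≤ M.gain i B := by
  refine Finset.sum_le_sum fun u hu => Finset.sum_le_sum fun v hv => ?_
  rw [Finset.mem_range] at hu hv
  split_ifs with h1 h2
  · exact le_rfl
  · exact absurd ⟨h1.1, h u hu v hv h1.1 h1.2⟩ h2
  · exact zero_le_one
  · exact le_rfl

/-- Vertex `v` is active at time `j` if activity intervals start at the times in `S v`. -/
def Covers (S : ℕ → Finset ℕ) (v j : ℕ) : Prop := ∃ s ∈ S v, s ≤ j ∧ j ≤ s + M.l

/-- The lifetime of vertex `v` is `[f v, e v]`, and states are only stored for vertices that cannot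
be active during their whole lifetime. -/
structure Lifetimes (f e : ℕ → ℕ) : Prop where
  one_le_k : 1 ≤ M.k
  alive_iff : ∀ i v, M.alive i v ↔ f v < i ∧ i ≤ e v ∧ M.k * (M.l + 1) ≤ e v - f v
  adj_left : ∀ i u v, M.adj i u v → f u ≤ i ∧ i ≤ e u
  adj_right : ∀ i u v, M.adj i u v → f v ≤ i ∧ i ≤ e v

/-! ### Values of the dynamic program are attained by start times -/

variable {M} {f e : ℕ → ℕ}

theorem Lifetimes.not_alive_zero (L : M.Lifetimes f e) (v : ℕ) : ¬ M.alive 0 v := by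
  simp [L.alive_iff]

/-- One vertex and one time step, backwards in time: start times within the budget of boundary `i +
1` become start times within the budget of boundary `i`. Coverage is only needed inside the
lifetime, since there are no incident edges elsewhere. -/
theorem Lifetimes.exists_starts (L : M.Lifetimes f e) {i : ℕ} {z z' : ℕ → ℕ}
    {v : ℕ} (hc : M.alive (i + 1) v → M.Keep i z z' v ∨ M.Starts i z z' v) (S' : Finset ℕ)
    (hS' : S'.card ≤ M.left (i + 1) z' v) :
    ∃ S : Finset ℕ, S.card ≤ M.left i z v ∧
      (f v ≤ i → i ≤ e v → M.Active i z z' v →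
        i < i + M.rem i z v ∨ ∃ s ∈ S, s ≤ i ∧ i ≤ s + M.l) ∧
      ∀ j, i + 1 ≤ j → f v ≤ j → j ≤ e v →
        (j < i + 1 + M.rem (i + 1) z' v ∨ ∃ s ∈ S', s ≤ j ∧ j ≤ s + M.l) →
        (j < i + M.rem i z v ∨ ∃ s ∈ S, s ≤ j ∧ j ≤ s + M.l) := by
  have hk : M.k * (M.l + 1) ≥ 1 := Nat.mul_pos L.one_le_k (Nat.succ_pos _)
  by_cases hl : M.k * (M.l + 1) ≤ e v - f v
  swap
  · have ha : ¬ M.alive i v := by rw [L.alive_iff]; tauto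
    -- A short lifetime is tiled by `k` consecutive intervals of `l + 1` time steps each.
    have key : ∀ j, f v ≤ j → j ≤ e v →
        ∃ s ∈ (Finset.range M.k).image (fun m => f v + m * (M.l + 1)), s ≤ j ∧ j ≤ s + M.l := by
      intro j h1 h2
      have h3 := Nat.div_add_mod (j - f v) (M.l + 1)
      have h4 := Nat.mod_lt (j - f v) (show 0 < M.l + 1 by omega)
      rw [mul_comm] at h3
      refine ⟨_, Finset.mem_image.2 ⟨(j - f v) / (M.l + 1), ?_, rfl⟩, by omega, by omega⟩
      rw [Finset.mem_range]
      exact Nat.div_lt_of_lt_mul (by rw [mul_comm]; omega)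
    refine ⟨_, ?_, fun h1 h2 _ => Or.inr (key i h1 h2), fun j _ h1 h2 _ => Or.inr (key j h1 h2)⟩
    rw [left, if_neg ha]
    exact Finset.card_image_le.trans (Finset.card_range _).le
  by_cases ha' : M.alive (i + 1) v
  · have hl' : M.left (i + 1) z' v = z' (M.n + v) := if_pos ha'
    have hr' : M.rem (i + 1) z' v = z' v := if_pos ha'
    by_cases hkeep : M.Keep i z z' v
    · refine ⟨S', hS'.trans (by rw [hl', hkeep.1]), ?_, ?_⟩
      · rintro _ _ (⟨_, h | h⟩ | ⟨h, _⟩)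
        · exact absurd hkeep h
        · left; omega
        · exact absurd ha' h
      · rintro j h1 h2 h3 (h | h)
        · left; rw [hr', hkeep.2] at h; omega
        · exact Or.inr h
    · have hst := (hc ha').resolve_left hkeep
      refine ⟨insert i S', (Finset.card_insert_le _ _).trans ?_, ?_, ?_⟩
      · rw [hst.1, ← hl']; omega
      · exact fun _ _ _ => Or.inr ⟨i, by simp⟩
      · rintro j h1 h2 h3 (h | ⟨s, hs, h⟩)
        · exact Or.inr ⟨i, by simp, by omega, by rw [hr', hst.2] at h; omega⟩
        · exact Or.inr ⟨s, by simp [hs], h⟩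
  have hl' : M.left (i + 1) z' v = M.k := if_neg ha'
  have hr' : M.rem (i + 1) z' v = 0 := if_neg ha'
  -- The lifetime is long, so `v` is not stored at boundary `i + 1` only because this boundary is
  -- not strictly inside the lifetime.
  have hi : i < f v ∨ e v ≤ i := by rw [L.alive_iff] at ha'; omega
  by_cases hif : i < f v
  · have ha : ¬ M.alive i v := by rw [L.alive_iff]; omega
    refine ⟨S', by rwa [left, if_neg ha, ← hl'], by omega, ?_⟩
    rintro j h1 h2 h3 (h | h)
    · omega
    · exact Or.inr h
  -- No later time matters for `v`, so an unused interval may be spent at time `i` and all other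
  -- starts dropped.
  · by_cases hz : M.left i z v = 0
    · refine ⟨∅, by simp, ?_, by omega⟩
      rintro _ _ (⟨h, _⟩ | ⟨_, h⟩)
      · exact absurd h ha'
      · left; omega
    · exact ⟨{i}, by simp; omega, fun _ _ _ => Or.inr ⟨i, by simp⟩, by omega⟩

open Classical in
-- Soundness of the dynamic program. A best successor is chosen; if it is incompatible, the value is
-- 0 and no starts are needed. Otherwise its start times are extended vertex by vertex with
-- `exists_starts`.
theorem Lifetimes.exists_value_le (L : M.Lifetimes f e) (q : ℕ) (hq : q ≤ M.T) (m : ℕ) :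
    ∃ S : ℕ → Finset ℕ,
      (∀ v, (S v).card ≤ M.left (M.T - q) (mixedDigit (M.radix (M.T - q)) m) v) ∧
      M.value q m ≤ ∑ j ∈ Finset.Ico (M.T - q) M.T, M.gain j fun v =>
        j < M.T - q + M.rem (M.T - q) (mixedDigit (M.radix (M.T - q)) m) v ∨ M.Covers S v j := by
  induction q generalizing m with
  | zero => exact ⟨fun _ => ∅, by simp, by simp [value]⟩
  | succ q ih =>
    obtain ⟨i, hi⟩ : ∃ i, M.T - (q + 1) = i := ⟨_, rfl⟩
    have hi1 : M.T - q = i + 1 := by omega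
    rw [value, hi]
    rw [hi1] at ih
    rcases Nat.eq_zero_or_pos (M.states (i + 1)) with h0 | h0
    · exact ⟨fun _ => ∅, by simp, by simp [h0]⟩
    obtain ⟨b, _, hb⟩ := Finset.exists_mem_eq_sup (Finset.range (M.states (i + 1)))
      ⟨0, Finset.mem_range.2 h0⟩ (fun b =>
        if M.Compatible i (mixedDigit (M.radix i) m) (mixedDigit (M.radix (i + 1)) b) then
          M.value q b + M.gain i (M.Active i (mixedDigit (M.radix i) m)
            (mixedDigit (M.radix (i + 1)) b))
        else 0)
    rw [hb]
    split_ifs with hc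
    swap
    · exact ⟨fun _ => ∅, by simp, by simp⟩
    obtain ⟨S', hS', hval⟩ := ih (by omega) b
    have key : ∀ v, ∃ S : Finset ℕ, v < M.n → S.card ≤ M.left i (mixedDigit (M.radix i) m) v ∧
      (f v ≤ i → i ≤ e v →
        M.Active i (mixedDigit (M.radix i) m) (mixedDigit (M.radix (i + 1)) b) v →
        i < i + M.rem i (mixedDigit (M.radix i) m) v ∨ ∃ s ∈ S, s ≤ i ∧ i ≤ s + M.l) ∧
      ∀ j, i + 1 ≤ j → f v ≤ j → j ≤ e v →
        (j < i + 1 + M.rem (i + 1) (mixedDigit (M.radix (i + 1)) b) v ∨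
          ∃ s ∈ S' v, s ≤ j ∧ j ≤ s + M.l) →
        (j < i + M.rem i (mixedDigit (M.radix i) m) v ∨ ∃ s ∈ S, s ≤ j ∧ j ≤ s + M.l) := by
      intro v
      by_cases hv : v < M.n
      · obtain ⟨S, hS⟩ := L.exists_starts (hc v hv) (S' v) (hS' v)
        exact ⟨S, fun _ => hS⟩
      · exact ⟨∅, fun h => absurd h hv⟩
    choose S hS using key
    -- Compatibility says nothing about indices that are not vertices; these get no starts, and
    -- `gain` ignores them.
    refine ⟨fun v => if v < M.n then S v else ∅, fun v => ?_, ?_⟩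
    · by_cases hv : v < M.n
      · simpa [hv] using (hS v hv).1
      · simp [hv]
    · rw [Finset.sum_eq_sum_Ico_succ_bot (by omega), add_comm]
      refine add_le_add (M.gain_mono ?_) (hval.trans (Finset.sum_le_sum fun j hj => M.gain_mono ?_))
      · rintro u hu v hv ha h
        refine h.imp (fun h => ?_) (fun h => ?_)
        · simpa [Covers, hu] using (hS u hu).2.1 (L.adj_left i u v ha).1 (L.adj_left i u v ha).2 h
        · simpa [Covers, hv] using (hS v hv).2.1 (L.adj_right i u v ha).1 (L.adj_right i u v ha).2 h
      · rintro u hu v hv ha h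
        have hj := (Finset.mem_Ico.1 hj).1
        refine h.imp (fun h => ?_) (fun h => ?_)
        · simpa [Covers, hu] using
            (hS u hu).2.2 j hj (L.adj_left j u v ha).1 (L.adj_left j u v ha).2 h
        · simpa [Covers, hv] using
            (hS v hv).2.2 j hj (L.adj_right j u v ha).1 (L.adj_right j u v ha).2 h

/-! ### The path of states traced out by given start times -/

/-- The remaining active time steps at boundary `i` if activity intervals start in `S`. -/
def remaining (l : ℕ) (S : Finset ℕ) : ℕ → ℕ
  | 0 => 0
  | i + 1 => if i ∈ S then l else remaining l S i - 1

theorem remaining_le (l : ℕ) (S : Finset ℕ) (i : ℕ) : remaining l S i ≤ l := by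
  induction i with
  | zero => exact Nat.zero_le _
  | succ i ih => rw [remaining]; split_ifs <;> omega

/-- A later start resets the counter to `l`, which can only postpone the end of activity;
overlapping intervals need no special care. -/
theorem le_remaining {l : ℕ} {S : Finset ℕ} {s : ℕ} (hs : s ∈ S) (i : ℕ) (hi : s < i) :
    s + l + 1 ≤ i + remaining l S i := by
  induction i with
  | zero => omega
  | succ i ih =>
    rw [remaining]
    split_ifs with h
    · omega
    · have := ih (by rcases Nat.lt_succ_iff_lt_or_eq.1 hi with h' | rfl; exacts [h', absurd hs h])
      omega

theorem remaining_eq_zero {l : ℕ} {S : Finset ℕ} {c : ℕ} (hS : ∀ s ∈ S, c ≤ s) (i : ℕ)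
    (hi : i ≤ c) : remaining l S i = 0 := by
  induction i with
  | zero => rfl
  | succ i ih =>
    rw [remaining, if_neg fun h => by have := hS i h; omega, ih (by omega)]

theorem card_filter_lt_succ (S : Finset ℕ) (i : ℕ) :
    (S.filter (· < i + 1)).card = (S.filter (· < i)).card + if i ∈ S then 1 else 0 := by
  split_ifs with h
  · rw [← Finset.card_insert_of_notMem (a := i) (by simp)]
    congr 1
    ext x
    simp only [Finset.mem_filter, Finset.mem_insert]
    constructor
    · rintro ⟨h1, h2⟩
      by_cases hx : x = i
      · exact Or.inl hx
      · exact Or.inr ⟨h1, by omega⟩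
    · rintro (rfl | ⟨h1, h2⟩)
      · exact ⟨h, by omega⟩
      · exact ⟨h1, by omega⟩
  · congr 1
    ext x
    simp only [Finset.mem_filter]
    constructor
    · rintro ⟨h1, h2⟩
      exact ⟨h1, lt_of_le_of_ne (by omega) (by rintro rfl; exact h h1)⟩
    · rintro ⟨h1, h2⟩
      exact ⟨h1, by omega⟩

variable (M) in
open Classical in
/-- The state at boundary `i` if activity intervals start at the times in `S v`. -/
noncomputable def trace (S : ℕ → Finset ℕ) (i j : ℕ) : ℕ :=
  if j < M.n then if M.alive i j then remaining M.l (S j) i else 0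
  else if M.alive i (j - M.n) then M.k - ((S (j - M.n)).filter (· < i)).card else 0

theorem trace_lt (S : ℕ → Finset ℕ) (i j : ℕ) : M.trace S i j < M.radix i j := by
  have := remaining_le M.l (S j) i
  unfold trace radix
  split_ifs <;> omega

theorem exists_mixedDigit_eq_trace (S : ℕ → Finset ℕ) (i : ℕ) :
    ∃ m < M.states i, ∀ j < M.n + M.n, mixedDigit (M.radix i) m j = M.trace S i j :=
  exists_mixedDigit_eq _ _ _ fun j _ => trace_lt S i j

/-- Up to the first time of a long lifetime, the default values `k` and 0 agree with the formulas of
the trace, as no interval has started yet. Thus one formula holds for all `i ≤ e v`. -/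
theorem Lifetimes.left_eq (L : M.Lifetimes f e) {S : ℕ → Finset ℕ} {i : ℕ} {z : ℕ → ℕ}
    (hz : ∀ j < M.n + M.n, z j = M.trace S i j) {v : ℕ} (hv : v < M.n) (hS : ∀ s ∈ S v, f v ≤ s)
    (hi : i ≤ e v) (hl : M.k * (M.l + 1) ≤ e v - f v) :
    M.left i z v = M.k - ((S v).filter (· < i)).card ∧ M.rem i z v = remaining M.l (S v) i := by
  unfold left rem
  split_ifs with h
  · rw [hz _ (by omega), hz _ (by omega), trace, trace, if_neg (by omega), if_pos hv,
      show M.n + v - M.n = v by omega, if_pos h, if_pos h]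
    exact ⟨rfl, rfl⟩
  · rw [L.alive_iff] at h
    have hif : i ≤ f v := by omega
    rw [remaining_eq_zero hS i hif, Finset.filter_false_of_mem]
    · simp
    · intro s hs
      have := hS s hs
      omega

/-- With at most `k` starts the truncated difference in `trace` is exact, so each start lowers the
budget by exactly one. -/
theorem Lifetimes.keep_or_starts (L : M.Lifetimes f e) {S : ℕ → Finset ℕ}
    {i : ℕ} {z z' : ℕ → ℕ} (hz : ∀ j < M.n + M.n, z j = M.trace S i j)
    (hz' : ∀ j < M.n + M.n, z' j = M.trace S (i + 1) j) {v : ℕ} (hv : v < M.n)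
    (hS : ∀ s ∈ S v, f v ≤ s) (hk : (S v).card ≤ M.k) (ha : M.alive (i + 1) v) :
    (i ∉ S v ∧ M.Keep i z z' v) ∨ (i ∈ S v ∧ M.Starts i z z' v) := by
  have ha' := (L.alive_iff _ _).1 ha
  obtain ⟨h1, h2⟩ := L.left_eq hz hv hS (by omega) ha'.2.2
  obtain ⟨h3, h4⟩ := L.left_eq hz' hv hS (by omega) ha'.2.2
  have h3' : M.left (i + 1) z' v = z' (M.n + v) := if_pos ha
  have h4' : M.rem (i + 1) z' v = z' v := if_pos ha
  rw [h3'] at h3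
  rw [h4'] at h4
  have hc := card_filter_lt_succ (S v) i
  have hle := (Finset.card_filter_le (S v) (· < i + 1)).trans hk
  unfold Keep Starts
  rw [h1, h2, h3, h4, remaining]
  by_cases hi : i ∈ S v
  · rw [if_pos hi] at hc ⊢
    exact Or.inr ⟨hi, by omega, rfl⟩
  · rw [if_neg hi] at hc ⊢
    exact Or.inl ⟨hi, by omega, rfl⟩

/-- An interval begun before `i` leaves a positive counter. One begun at `i` is either a visible
start transition or, if `v` is no longer stored at `i + 1`, shows that the budget at `i` is
positive. A short-lived vertex is active because `k ≥ 1`. -/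
theorem Lifetimes.active_of_covers (L : M.Lifetimes f e) {S : ℕ → Finset ℕ}
    {i : ℕ} {z z' : ℕ → ℕ} (hz : ∀ j < M.n + M.n, z j = M.trace S i j)
    (hz' : ∀ j < M.n + M.n, z' j = M.trace S (i + 1) j) {v : ℕ} (hv : v < M.n)
    (hS : ∀ s ∈ S v, f v ≤ s) (hk : (S v).card ≤ M.k) (he : i ≤ e v)
    (hc : M.Covers S v i) : M.Active i z z' v := by
  have h1k := L.one_le_k
  obtain ⟨s, hs, hsi, his⟩ := hc
  by_cases hl : M.k * (M.l + 1) ≤ e v - f v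
  swap
  · right
    have h1 : ¬ M.alive (i + 1) v := by rw [L.alive_iff]; tauto
    have h2 : ¬ M.alive i v := by rw [L.alive_iff]; tauto
    refine ⟨h1, ?_⟩
    rw [left, if_neg h2]
    omega
  obtain ⟨h1, h2⟩ := L.left_eq hz hv hS he hl
  have hr : i ∉ S v → M.rem i z v ≠ 0 := by
    intro hi
    have := le_remaining (l := M.l) hs i (lt_of_le_of_ne hsi (by rintro rfl; exact hi hs))
    omega
  by_cases ha : M.alive (i + 1) v
  · left
    refine ⟨ha, ?_⟩
    rcases L.keep_or_starts hz hz' hv hS hk ha with ⟨h, _⟩ | ⟨_, h⟩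
    · exact Or.inr (hr h)
    · left
      intro h'
      have := h.1
      have := h'.1
      omega
  · right
    refine ⟨ha, ?_⟩
    by_cases hi : i ∈ S v
    · have hc := card_filter_lt_succ (S v) i
      have hle := (Finset.card_filter_le (S v) (· < i + 1)).trans hk
      rw [if_pos hi] at hc
      omega
    · have := hr hi
      omega

/-- Completeness of the dynamic program: the traced states are compatible, and each step gains at
least the pairs covered by `S`. -/
theorem Lifetimes.le_value (L : M.Lifetimes f e) {S : ℕ → Finset ℕ}
    (hS : ∀ v, ∀ s ∈ S v, f v ≤ s) (hk : ∀ v, (S v).card ≤ M.k) (q : ℕ) (hq : q ≤ M.T) (m : ℕ)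
    (hm : ∀ j < M.n + M.n, mixedDigit (M.radix (M.T - q)) m j = M.trace S (M.T - q) j) :
    ∑ j ∈ Finset.Ico (M.T - q) M.T, M.gain j (fun v => M.Covers S v j) ≤ M.value q m := by
  induction q generalizing m with
  | zero => simp
  | succ q ih =>
    obtain ⟨i, hi⟩ : ∃ i, M.T - (q + 1) = i := ⟨_, rfl⟩
    have hi1 : M.T - q = i + 1 := by omega
    rw [value]
    rw [hi] at hm ⊢
    rw [hi1] at ih
    obtain ⟨b, hb, hb'⟩ := exists_mixedDigit_eq_trace (M := M) S (i + 1)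
    refine le_trans ?_ (Finset.le_sup (Finset.mem_range.2 hb))
    have hC : M.Compatible i (mixedDigit (M.radix i) m) (mixedDigit (M.radix (i + 1)) b) :=
      fun v hv ha => (L.keep_or_starts hm hb' hv (hS v) (hk v) ha).imp And.right And.right
    rw [if_pos hC]
    rw [Finset.sum_eq_sum_Ico_succ_bot (by omega), add_comm]
    refine add_le_add (ih (by omega) b hb') (M.gain_mono fun u hu v hv ha => ?_)
    exact Or.imp (L.active_of_covers hm hb' hu (hS u) (hk u) (L.adj_left i u v ha).2)
      (L.active_of_covers hm hb' hv (hS v) (hk v) (L.adj_right i u v ha).2)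

/-- The value computed by the dynamic program is the largest number of covered ordered pairs. -/
theorem Lifetimes.le_value_iff (L : M.Lifetimes f e) (t : ℕ) :
    t ≤ M.value M.T 0 ↔ ∃ S : ℕ → Finset ℕ, (∀ v, (S v).card ≤ M.k) ∧
      t ≤ ∑ j ∈ Finset.range M.T, M.gain j fun v => M.Covers S v j := by
  constructor
  · intro h
    obtain ⟨S, hS, hval⟩ := L.exists_value_le M.T le_rfl 0
    rw [Nat.sub_self] at hS hval
    -- At boundary 0 no vertex is stored: every budget is `k` and no interval is running.
    refine ⟨S, fun v => (hS v).trans_eq (if_neg (L.not_alive_zero v)), h.trans (hval.trans_eq ?_)⟩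
    rw [← Finset.range_eq_Ico]
    refine Finset.sum_congr rfl fun j _ => ?_
    congr 1
    funext v
    simp [rem, L.not_alive_zero v]
  · rintro ⟨S, hS, ht⟩
    -- Starts before the lifetime are moved to its first time, which loses no coverage inside the
    -- lifetime.
    have key := L.le_value (S := fun v => (S v).image (max (f v))) (fun v s hs => by
      obtain ⟨x, _, rfl⟩ := Finset.mem_image.1 hs
      exact le_max_left _ _) (fun v => Finset.card_image_le.trans (hS v)) M.T le_rfl 0 (by
        intro j _
        rw [mixedDigit_zero, Nat.sub_self, trace]
        simp [L.not_alive_zero])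
    rw [Nat.sub_self, ← Finset.range_eq_Ico] at key
    refine ht.trans (le_trans (Finset.sum_le_sum fun j _ => M.gain_mono ?_) key)
    intro u hu v hv ha
    have aux : ∀ w, f w ≤ j → M.Covers S w j →
        M.Covers (fun v => (S v).image (max (f v))) w j := by
      rintro w hw ⟨s, hs, h1, h2⟩
      exact ⟨max (f w) s, Finset.mem_image_of_mem _ hs, max_le hw h1, by omega⟩
    exact Or.imp (aux u (L.adj_left j u v ha).1) (aux v (L.adj_right j u v ha).1)

end Model

/-! ### Subroutines of the dynamic program -/

namespace Stmt

open Expr (const var add sub rd inp cond)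

/-- The parts of the store on which the model depends are not changed. -/
def keeps (p : Stmt) : Bool :=
  !(p.writesVar .n || p.writesVar .T || p.writesVar .k || p.writesVar .l || p.writesVar .X ||
    p.writesVar .n2 || p.writesArr .start || p.writesArr .last)

end Stmt

/-- The store `h` holds the data of the model `M`. -/
structure Model.Link (M : Model) (h : Store) : Prop where
  n : h.var .n = M.n
  T : h.var .T = M.T
  k : h.var .k = M.k
  l : h.var .l = M.l
  n2 : h.var .n2 = M.n * M.n
  adj : ∀ i u v, i < M.T → u < M.n → v < M.n → (h.inp ((i * M.n + u) * M.n + v) ≠ 0 ↔ M.adj i u v)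
  alive : ∀ i v, i ≤ M.T → v < M.n → (M.alive i v ↔ M.T - h.arr .start v < i ∧ i ≤ h.arr .last v ∧
    h.var .X ≤ h.arr .last v - (M.T - h.arr .start v))

theorem Model.Link.frame {M : Model} {h h' : Store} {p : Stmt} (L : M.Link h)
    (F : Stmt.Frame p h h') (hp : p.keeps = true) : M.Link h' := by
  simp only [Stmt.keeps, Bool.not_eq_true', Bool.or_eq_false_iff] at hp
  obtain ⟨⟨⟨⟨⟨⟨⟨h1, h2⟩, h3⟩, h4⟩, h5⟩, h6⟩, h7⟩, h8⟩ := hp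
  exact ⟨by rw [F.var _ h1, L.n], by rw [F.var _ h2, L.T], by rw [F.var _ h3, L.k],
    by rw [F.var _ h4, L.l], by rw [F.var _ h6, L.n2], by rw [F.inp]; exact L.adj,
    by rw [F.arr _ h7, F.arr _ h8, F.var _ h5]; exact L.alive⟩

namespace Stmt

open Expr (const var add sub rd inp cond)

/-- Fill an array of digits with zeros. -/
def clear (D : Arr) : Stmt := loop .j (add (var .n) (var .n)) (sto D (var .j) (const 0))

theorem spec_clear (D : Arr) (h : Store) :
    (clear D).Spec h (9 + (h.var .n + h.var .n) * 20) fun h' =>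
      ∀ j < h.var .n + h.var .n, h'.arr D j = 0 := by
  refine spec_loop (b := 11) rfl (by simp [Expr.eval]) (fun m h' => ∀ j < m, h'.arr D j = 0)
    (by simp) ?_
  intro m hm h' F hj hI
  refine spec_of_loopFree rfl (Nat.le_of_ble_eq_true rfl) ?_
  intro j hjm
  simp only [run, Store.setVar_arr, Store.setArr_arr, true_and, Expr.eval, hj]
  split_ifs with h
  · rfl
  · exact hI j (by omega)

/-- Increase the number with the digits in `D` by one; the radices are in `R`. -/
def incr (D R : Arr) : Stmt :=
  seq (asg .carry (const 1)) (loop .j (add (var .n) (var .n))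
    (ite (var .carry)
      (seq (sto D (var .j) (add (rd D (var .j)) (const 1)))
        (ite (.eq (rd D (var .j)) (rd R (var .j))) (sto D (var .j) (const 0))
          (asg .carry (const 0))))
      skip))

/-- Ripple carry: after `s` digits the carry is set exactly if the product of the first `s` radices
divides `m + 1`. Overflow of the last digit wraps around to 0, in accordance with `mixedDigit`. -/
theorem spec_incr {D R : Arr} (hDR : D ≠ R) {h : Store} {f : ℕ → ℕ} (hf : ∀ j, 0 < f j) {m : ℕ}
    (hR : ∀ j < h.var .n + h.var .n, h.arr R j = f j)
    (hD : ∀ j < h.var .n + h.var .n, h.arr D j = mixedDigit f m j) :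
    (incr D R).Spec h (12 + (h.var .n + h.var .n) * 109) fun h' =>
      ∀ j < h.var .n + h.var .n, h'.arr D j = mixedDigit f (m + 1) j := by
  refine (Spec.seq (b := 3) (Q := fun h' => h' = h.setVar .carry 1) (spec_asg (e := const 1) rfl)
    ?_).mono (b := 3 + (9 + (h.var .n + h.var .n) * 109)) (by omega) fun _ _ h => h
  rintro _ - rfl
  refine (spec_loop (b := 100) rfl rfl (fun s h' =>
    (h'.var .carry ≠ 0 ↔ (∏ x ∈ Finset.range s, f x) ∣ m + 1) ∧
    ∀ j < h.var .n + h.var .n, h'.arr D j = mixedDigit f (if j < s then m + 1 else m) j) ?_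
    ?_).mono (by simp [Expr.eval, Expr.size]) ?_
  · simpa [Expr.eval] using hD
  swap
  · rintro h' - ⟨-, h2⟩ j hj
    have := h2 j hj
    rwa [if_pos (by simpa [Expr.eval] using hj)] at this
  intro s hs h' F hj ⟨hc, hI⟩
  have hs' : s < h.var .n + h.var .n := by simpa [Expr.eval] using hs
  have hR' : h'.arr R s = f s := by
    rw [F.arr R (by simpa [loop, writesArr] using hDR.symm)]
    exact hR s hs'
  have hDs := hI s hs'
  rw [if_neg (lt_irrefl s)] at hDs
  have hP : 0 < ∏ x ∈ Finset.range s, f x := Finset.prod_pos fun x _ => hf x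
  have h1 := prod_range_succ_dvd_iff f m s hP (hf s)
  have h2 := mixedDigit_succ f m s
  have aux : ∀ j < h.var .n + h.var .n, j ≠ s →
      h'.arr D j = mixedDigit f (if j < s + 1 then m + 1 else m) j := by
    intro j hj hjs
    rw [hI j hj]
    congr 1
    exact if_congr (by omega) rfl rfl
  refine spec_of_loopFree rfl (Nat.le_of_ble_eq_true rfl) ?_
  by_cases hcz : h'.var .carry = 0
  · have hd : ¬ (∏ x ∈ Finset.range s, f x) ∣ m + 1 := by rw [← hc]; simpa using hcz
    rw [if_neg hd] at h2
    simp only [run, Expr.eval, hcz, ne_eq, not_true, if_false, Store.setVar_var, Store.setVar_arr,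
      reduceCtorEq, false_iff]
    refine ⟨fun h => hd (h1.1 h).1, fun j hj => ?_⟩
    by_cases hjs : j = s
    · subst hjs; rw [hDs, if_pos (by omega), h2]
    · exact aux j hj hjs
  · have hd := hc.1 hcz
    rw [if_pos hd] at h2
    by_cases he : mixedDigit f m s + 1 = f s
    · rw [if_pos he] at h2
      simp only [run, Expr.eval, hcz, ne_eq, not_false_eq_true, if_true, hj, Store.setArr_arr,
        hDs, and_self, hDR.symm, false_and, if_false, hR', he, Nat.sub_self, Nat.add_zero,
        not_true, one_ne_zero, Store.setVar_arr, Store.setVar_var, reduceCtorEq, Store.setArr_var,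
        true_iff, true_and]
      refine ⟨h1.2 ⟨hd, he⟩, fun j hj => ?_⟩
      by_cases hjs : j = s
      · subst hjs; rw [if_pos rfl, if_pos (by omega), h2]
      · rw [if_neg hjs, if_neg hjs]; exact aux j hj hjs
    · rw [if_neg he] at h2
      have he' : mixedDigit f m s + 1 - f s + (f s - (mixedDigit f m s + 1)) ≠ 0 := by omega
      simp only [run, Expr.eval, hcz, ne_eq, not_false_eq_true, if_true, hj, Store.setArr_arr,
        hDs, and_self, hDR.symm, false_and, if_false, hR', he', Store.setArr_var,
        not_true, Store.setVar_arr, Store.setVar_var, reduceCtorEq,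
        true_and, false_iff]
      refine ⟨fun h => he (h1.1 h).2, fun j hj => ?_⟩
      by_cases hjs : j = s
      · subst hjs; rw [if_pos rfl, if_pos (by omega), h2]
      · rw [if_neg hjs]; exact aux j hj hjs

/-- Compute the vertices alive at the boundary in `p`, and the radices of the states. -/
def radices (A R : Arr) : Stmt :=
  loop .v (var .n)
    (seq (sto A (var .v) (.and (.lt (sub (var .T) (rd .start (var .v))) (var .p))
        (.and (.lt (var .p) (add (rd .last (var .v)) (const 1)))
          (.lt (var .X) (add (sub (rd .last (var .v)) (sub (var .T) (rd .start (var .v))))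
            (const 1))))))
      (seq (sto R (var .v) (cond (rd A (var .v)) (add (var .l) (const 1)) (const 1)))
        (sto R (add (var .n) (var .v)) (cond (rd A (var .v)) (add (var .k) (const 1)) (const 1)))))

theorem spec_radices {A R : Arr} (hAR : A ≠ R) (hA1 : A ≠ .start) (hA2 : A ≠ .last)
    (hR1 : R ≠ .start) (hR2 : R ≠ .last) {M : Model} {h : Store} (L : M.Link h) {i : ℕ}
    (hi : i ≤ M.T) (hp : h.var .p = i) :
    (radices A R).Spec h (6 + M.n * 309) fun h' =>
      (∀ v < M.n, h'.arr A v ≠ 0 ↔ M.alive i v) ∧ ∀ j < M.n + M.n, h'.arr R j = M.radix i j := by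
  refine (spec_loop (b := 300) rfl rfl (fun s h' =>
    (∀ v < s, h'.arr A v ≠ 0 ↔ M.alive i v) ∧
    ∀ v < s, h'.arr R v = M.radix i v ∧ h'.arr R (M.n + v) = M.radix i (M.n + v)) (by simp)
    ?_).mono (by simp [Expr.eval, Expr.size, L.n]) ?_
  swap
  · rintro h' - ⟨h1, h2⟩
    simp only [Expr.eval, Store.setVar_var, reduceCtorEq, if_false, L.n] at h1 h2
    refine ⟨h1, fun j hj => ?_⟩
    by_cases hjn : j < M.n
    · exact (h2 j hjn).1
    · have := (h2 (j - M.n) (by omega)).2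
      rwa [show M.n + (j - M.n) = j by omega] at this
  intro s hs h' F hv ⟨hI1, hI2⟩
  have hs' : s < M.n := by simpa [Expr.eval, L.n] using hs
  have L' : M.Link h' := L.frame F (by
    simp [keeps, writesVar, writesArr, loop, hA1.symm, hA2.symm, hR1.symm, hR2.symm])
  have hp' : h'.var .p = i := (F.var .p rfl).trans hp
  refine spec_of_loopFree rfl (Nat.le_of_ble_eq_true rfl) ?_
  have ha := L'.alive i s hi hs'
  set w := Expr.eval h' (.and (.lt (sub (var .T) (rd .start (var .v))) (var .p))
        (.and (.lt (var .p) (add (rd .last (var .v)) (const 1)))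
          (.lt (var .X) (add (sub (rd .last (var .v)) (sub (var .T) (rd .start (var .v))))
            (const 1))))) with hw
  have hwa : w ≠ 0 ↔ M.alive i s := by
    rw [ha, hw]
    simp only [Expr.eval, hv, hp', L'.T]
    split_ifs <;> simp <;> omega
  classical
  have r1 : M.radix i s = if w ≠ 0 then M.l + 1 else 1 := by
    rw [Model.radix, if_pos hs']; exact if_congr hwa.symm rfl rfl
  have r2 : M.radix i (M.n + s) = if w ≠ 0 then M.k + 1 else 1 := by
    rw [Model.radix, if_neg (by omega), Nat.add_sub_cancel_left]
    exact if_congr hwa.symm rfl rfl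
  simp only [run, ← hw]
  simp only [Expr.eval, hv, Store.setVar_arr, Store.setArr_arr, Store.setArr_var, hAR, hAR.symm,
    false_and, if_false, true_and, if_true, L'.l, L'.k, L'.n, ← r1, ← r2]
  refine ⟨fun v hvs => ?_, fun v hvs => ?_⟩
  · by_cases hvs' : v = s
    · subst hvs'; rwa [if_pos rfl]
    · rw [if_neg hvs']; exact hI1 v (by omega)
  · by_cases hvs' : v = s
    · subst hvs'; simp; omega
    · obtain ⟨h1, h2⟩ := hI2 v (by omega)
      have : M.n + v ≠ s := by omega
      simp [hvs', this, h1, h2]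
      omega

/-- Compute the product of the radices in `g`. -/
def product (R : Arr) : Stmt :=
  seq (asg .g (const 1)) (loop .j (add (var .n) (var .n))
    (seq (asg .acc (const 0))
      (seq (rep (rd R (var .j)) (asg .acc (add (var .acc) (var .g)))) (asg .g (var .acc)))))

/-- Each multiplication is a repeated addition whose length is the radix, so the time depends on a
bound `b` for the radices and not on the product. -/
theorem spec_product {R : Arr} {h : Store} {f : ℕ → ℕ} {b : ℕ}
    (hR : ∀ j < h.var .n + h.var .n, h.arr R j = f j) (hb : ∀ j < h.var .n + h.var .n, f j ≤ b) :
    (product R).Spec h (12 + (h.var .n + h.var .n) * (b * 10 + 30)) fun h' =>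
      h'.var .g = ∏ j ∈ Finset.range (h.var .n + h.var .n), f j := by
  refine (Spec.seq (b := 3) (Q := fun h' => h' = h.setVar .g 1) (spec_asg (e := const 1) rfl)
    ?_).mono (b := 3 + (9 + (h.var .n + h.var .n) * (b * 10 + 30))) (by omega) fun _ _ h => h
  rintro _ - rfl
  refine (spec_loop (b := b * 10 + 21) rfl rfl
    (fun s h' => h'.var .g = ∏ j ∈ Finset.range s, f j) (by simp)
    ?_).mono (by simp [Expr.eval, Expr.size, add_assoc]) ?_
  swap
  · intro h' _ h1
    simpa [Expr.eval] using h1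
  intro s hs h' F hj hI
  have hs' : s < h.var .n + h.var .n := by simpa [Expr.eval] using hs
  have hR' : h'.arr R s = f s := by rw [F.arr R (by rfl)]; exact hR s hs'
  refine (Spec.seq (b := 3) (Q := fun h'' => h'' = h'.setVar .acc 0) (spec_asg (e := const 0) rfl)
    (Q' := fun h' => h'.var .g = ∏ j ∈ Finset.range (s + 1), f j)
    (b' := (11 + b * 10) + 4) ?_).mono (by omega) fun h'' _ hQ => by simpa using hQ
  rintro _ - rfl
  refine Spec.seq (b := 11 + b * 10) (Q := fun h'' => h''.var .acc = f s * ∏ j ∈ Finset.range s, f j)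
    ?_ ?_
  · refine (spec_rep (N := f s) (b := 7) (by simp [Expr.eval, hj, hR'])
      (fun m h'' => h''.var .acc = m * ∏ j ∈ Finset.range s, f j) (by simp) ?_).mono ?_
      fun _ _ hQ => hQ
    · intro m hm h'' F'' hacc
      refine spec_of_loopFree rfl (Nat.le_of_ble_eq_true rfl) ?_
      have hg : h''.var .g = ∏ j ∈ Finset.range s, f j := by
        rw [F''.var .g rfl]; simpa using hI
      simp [run, Expr.eval, hg, hacc]
      ring
    · have := Nat.mul_le_mul_right 10 (hb s hs')
      simp [Expr.size]
      omega
  · intro h'' _ hacc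
    refine spec_of_loopFree rfl (Nat.le_of_ble_eq_true rfl) ?_
    simp [run, Expr.eval, hacc, Finset.prod_range_succ, mul_comm]

/-- Set `ok` to `0` if the states in `dig` and `dig'` are not compatible, and to `1` otherwise.
In the latter case, store the active vertices in `act`. -/
def check : Stmt :=
  seq (asg .ok (const 1)) (loop .v (var .n)
    (seq (asg .c (cond (rd .alive (var .v)) (rd .dig (add (var .n) (var .v))) (var .k)))
      (seq (asg .r (cond (rd .alive (var .v)) (rd .dig (var .v)) (const 0)))
        (ite (rd .alive' (var .v))
          (ite (.and (.eq (rd .dig' (add (var .n) (var .v))) (var .c))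
              (.eq (rd .dig' (var .v)) (sub (var .r) (const 1))))
            (sto .act (var .v) (var .r))
            (ite (.and (.eq (var .c) (add (rd .dig' (add (var .n) (var .v))) (const 1)))
                (.eq (rd .dig' (var .v)) (var .l)))
              (sto .act (var .v) (const 1))
              (asg .ok (const 0))))
          (sto .act (var .v) (add (var .c) (var .r)))))))

theorem sub_add_sub_eq_zero {x y : ℕ} : (x - y) + (y - x) ≠ 0 ↔ x ≠ y := by omega

/-- Nonzero entries of `act` mark active vertices: the running counter if nothing starts, 1 at a
start, and budget plus counter if the vertex is not stored afterwards. A failing vertex writes no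
mark, so `act` is only meaningful for compatible states. -/
theorem spec_check {M : Model} {h : Store} (L : M.Link h) {i : ℕ} {z z' : ℕ → ℕ}
    (ha : ∀ v < M.n, h.arr .alive v ≠ 0 ↔ M.alive i v)
    (ha' : ∀ v < M.n, h.arr .alive' v ≠ 0 ↔ M.alive (i + 1) v)
    (hz : ∀ j < M.n + M.n, h.arr .dig j = z j) (hz' : ∀ j < M.n + M.n, h.arr .dig' j = z' j) :
    check.Spec h (9 + M.n * 309) fun h' =>
      (h'.var .ok ≠ 0 ↔ M.Compatible i z z') ∧
      (M.Compatible i z z' → ∀ v < M.n, h'.arr .act v ≠ 0 ↔ M.Active i z z' v) := by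
  refine (Spec.seq (b := 3) (Q := fun h' => h' = h.setVar .ok 1) (spec_asg (e := const 1) rfl)
    ?_).mono (b := 3 + (6 + M.n * 309)) (by omega) fun _ _ h => h
  rintro _ - rfl
  refine (spec_loop (b := 300) rfl rfl (fun s h' =>
    (h'.var .ok ≠ 0 ↔ ∀ v < s, M.alive (i + 1) v → M.Keep i z z' v ∨ M.Starts i z z' v) ∧
    ((∀ v < s, M.alive (i + 1) v → M.Keep i z z' v ∨ M.Starts i z z' v) →
      ∀ v < s, h'.arr .act v ≠ 0 ↔ M.Active i z z' v)) (by simp)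
    ?_).mono (by simp [Expr.eval, Expr.size, L.n]) ?_
  swap
  · intro h' _ h1
    simp only [Expr.eval, Store.setVar_var, reduceCtorEq, if_false, L.n] at h1
    exact h1
  intro s hs h' F hv ⟨hI1, hI2⟩
  have hs' : s < M.n := by simpa [Expr.eval, L.n] using hs
  have e1 : h'.arr .alive = h.arr .alive := by rw [F.arr .alive rfl]; rfl
  have e2 : h'.arr .alive' = h.arr .alive' := by rw [F.arr .alive' rfl]; rfl
  have e3 : h'.arr .dig = h.arr .dig := by rw [F.arr .dig rfl]; rfl
  have e4 : h'.arr .dig' = h.arr .dig' := by rw [F.arr .dig' rfl]; rfl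
  have e5 : h'.var .n = M.n := by rw [F.var .n rfl]; simp [L.n]
  have e6 : h'.var .k = M.k := by rw [F.var .k rfl]; simp [L.k]
  have e7 : h'.var .l = M.l := by rw [F.var .l rfl]; simp [L.l]
  classical
  have hleft : (if h.arr .alive s ≠ 0 then h.arr .dig (M.n + s) else M.k) = M.left i z s := by
    rw [Model.left, hz _ (by omega)]; exact if_congr (ha s hs') rfl rfl
  have hrem : (if h.arr .alive s ≠ 0 then h.arr .dig s else 0) = M.rem i z s := by
    rw [Model.rem, hz _ (by omega)]; exact if_congr (ha s hs') rfl rfl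
  have all : (∀ v < s + 1, M.alive (i + 1) v → M.Keep i z z' v ∨ M.Starts i z z' v) ↔
      (∀ v < s, M.alive (i + 1) v → M.Keep i z z' v ∨ M.Starts i z z' v) ∧
      (M.alive (i + 1) s → M.Keep i z z' s ∨ M.Starts i z z' s) := by
    constructor
    · exact fun H => ⟨fun v hv => H v (by omega), H s (by omega)⟩
    · rintro ⟨H1, H2⟩ v hv
      rcases Nat.lt_succ_iff_lt_or_eq.1 hv with hv | rfl
      exacts [H1 v hv, H2]
  have key : ∀ w, (w ≠ 0 ↔ M.Active i z z' s) →
      (∀ v < s, h'.arr .act v ≠ 0 ↔ M.Active i z z' v) →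
      ∀ v < s + 1, (if v = s then w else h'.arr .act v) ≠ 0 ↔ M.Active i z z' v := by
    intro w hw H v hv
    by_cases hvs : v = s
    · subst hvs; rwa [if_pos rfl]
    · rw [if_neg hvs]; exact H v (by omega)
  have hA' := ha' s hs'
  have d1 := hz' (M.n + s) (by omega)
  have d2 := hz' s (by omega)
  refine spec_of_loopFree rfl (Nat.le_of_ble_eq_true rfl) ?_
  rw [all]
  simp only [run, Expr.eval, Store.setVar_var, Store.setVar_arr, hv, e1, e2, e3, e4, e5, e6, e7,
    reduceCtorEq, if_true, if_false, hleft, hrem, d1, d2, sub_add_sub_eq_zero]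
  by_cases hal : M.alive (i + 1) s
  · rw [if_pos (hA'.2 hal)]
    by_cases hk : M.Keep i z z' s
    · rw [if_pos (by simp [hk.1, hk.2])]
      simp only [Store.setArr_var, Store.setVar_var, Store.setArr_arr, Store.setVar_arr,
        reduceCtorEq, if_false, true_and, hk, true_or, implies_true, and_true]
      exact ⟨hI1, fun H => key _ (by simp [Model.Active, hal, hk]) (hI2 H)⟩
    · rw [if_neg (by simp only [Model.Keep] at hk; split_ifs <;> simp <;> omega)]
      by_cases hst : M.Starts i z z' s
      · rw [if_pos (by simp [hst.1, hst.2])]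
        simp only [Store.setArr_var, Store.setVar_var, Store.setArr_arr, Store.setVar_arr,
          reduceCtorEq, if_false, true_and, hst, or_true, implies_true, and_true]
        exact ⟨hI1, fun H => key _ (by simp [Model.Active, hal, hk]) (hI2 H)⟩
      · rw [if_neg (by simp only [Model.Starts] at hst; split_ifs <;> simp <;> omega)]
        simp [hk, hst, hal]
  · rw [if_neg (by rwa [hA'])]
    simp only [Store.setArr_var, Store.setVar_var, Store.setArr_arr, Store.setVar_arr,
      reduceCtorEq, if_false, true_and, hal, false_implies, and_true]
    exact ⟨hI1, fun H => key _ (by simp [Model.Active, hal]) (hI2 H)⟩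

/-- Add to the value of state `b` the number of ordered pairs that are adjacent in the snapshot with
address `row`, and of which one is marked in `act`. -/
def addGain : Stmt :=
  seq (asg .p (var .row)) (seq (asg .g (rd .val (var .b)))
    (loop .u (var .n) (loop .v (var .n)
      (seq (ite (inp (var .p))
          (ite (add (rd .act (var .u)) (rd .act (var .v))) (asg .g (add (var .g) (const 1))) skip)
          skip)
        (asg .p (add (var .p) (const 1)))))))

/-- The pairs are visited in the order of their addresses, so incrementing `p` replaces all address
arithmetic. -/
theorem spec_addGain {M : Model} {h : Store} (L : M.Link h) {i : ℕ} (hi : i < M.T)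
    {A : ℕ → Prop} (hrow : h.var .row = i * (M.n * M.n))
    (hA : ∀ v < M.n, h.arr .act v ≠ 0 ↔ A v) :
    addGain.Spec h (22 + M.n * (M.n * 109 + 15)) fun h' =>
      h'.var .g = h.arr .val (h.var .b) + M.gain i A := by
  classical
  refine (Spec.seq (b := 4) (Q := fun h' => h' = h.setVar .p (i * (M.n * M.n)))
    (spec_asg (e := var .row) (by simp [Expr.eval, hrow])) ?_).mono
    (b := 4 + (12 + (6 + M.n * (M.n * 109 + 15)))) (by omega) fun _ _ h => h
  rintro _ - rfl
  refine Spec.seq (b := 12) (Q := fun h' => h' = (h.setVar .p (i * (M.n * M.n))).setVar .g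
    (h.arr .val (h.var .b)))
    (spec_asg (e := rd .val (var .b)) (by simp [Expr.eval])) ?_
  rintro _ - rfl
  have hn := L.n
  refine (spec_loop (b := 6 + M.n * 109) rfl rfl (fun u h' =>
    h'.var .p = (i * M.n + u) * M.n ∧ h'.var .g = h.arr .val (h.var .b) +
      ∑ u ∈ Finset.range u, ∑ v ∈ Finset.range M.n, if M.adj i u v ∧ (A u ∨ A v) then 1 else 0)
    (by simp; ring) ?_).mono (by simp [Expr.eval, Expr.size, L.n]; apply le_of_eq; ring) ?_
  swap
  · rintro h' - ⟨-, h1⟩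
    simp only [Expr.eval, Store.setVar_var, reduceCtorEq, if_false, L.n] at h1
    rw [h1, Model.gain]
  intro u hu h' F huv ⟨hI1, hI2⟩
  have hu' : u < M.n := by simpa [Expr.eval, L.n] using hu
  have hn' : h'.var .n = M.n := by rw [F.var .n rfl]; simp [L.n]
  have ha : h'.arr .act = h.arr .act := by rw [F.arr .act rfl]; rfl
  have hin : h'.inp = h.inp := by rw [F.inp]; rfl
  refine (spec_loop (b := 100) rfl rfl (fun v h'' =>
    h''.var .p = (i * M.n + u) * M.n + v ∧ h''.var .g = h.arr .val (h.var .b) +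
      (∑ u ∈ Finset.range u, ∑ v ∈ Finset.range M.n, if M.adj i u v ∧ (A u ∨ A v) then 1 else 0) +
      ∑ v ∈ Finset.range v, if M.adj i u v ∧ (A u ∨ A v) then 1 else 0)
    (by simp [hI1, hI2]) ?_).mono (by simp [Expr.eval, Expr.size, hn']) ?_
  swap
  · rintro h'' - ⟨h1, h2⟩
    simp only [Expr.eval, Store.setVar_var, reduceCtorEq, if_false, hn'] at h1 h2 ⊢
    refine ⟨by rw [h1]; ring, ?_⟩
    rw [h2, Finset.sum_range_succ _ u, add_assoc]
  intro v hv h'' F' hvv ⟨hJ1, hJ2⟩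
  have hv' : v < M.n := by simpa [Expr.eval, hn'] using hv
  have huv' : h''.var .u = u := by rw [F'.var .u rfl]; simp [huv]
  have ha' : h''.arr .act = h.arr .act := by rw [F'.arr .act rfl]; exact ha
  have hin' : h''.inp = h.inp := by rw [F'.inp]; exact hin
  refine spec_of_loopFree rfl (Nat.le_of_ble_eq_true rfl) ?_
  have hadj := L.adj i u v hi hu' hv'
  have hact : h.arr .act u + h.arr .act v ≠ 0 ↔ A u ∨ A v := by
    rw [← hA u hu', ← hA v hv']; omega
  rw [Finset.sum_range_succ, ← add_assoc (h.arr .val (h.var .b) + _), ← hJ2]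
  simp only [and_congr hadj.symm hact.symm]
  simp only [run, Expr.eval, hJ1, hvv, huv', ha', hin']
  by_cases h1 : h.inp ((i * M.n + u) * M.n + v) = 0
  · simp [h1, hJ1, add_assoc]
  · by_cases h2 : h.arr .act u + h.arr .act v = 0
    · simp only [h2]; simp [h1, hJ1, add_assoc]
    · simp only [ne_eq, h1, h2]; simp [hJ1, add_assoc]

end Stmt

/-! ### The program -/

/-- The store `h` holds the data that is used in the step for the time `i`. -/
structure Model.StepContext (M : Model) (h : Store) (i : ℕ) : Prop where
  link : M.Link h
  lt : i < M.T
  row : h.var .row = i * (M.n * M.n)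
  Na : h.var .Na = M.states i
  Nb : h.var .Nb = M.states (i + 1)
  alive : ∀ v < M.n, h.arr .alive v ≠ 0 ↔ M.alive i v
  alive' : ∀ v < M.n, h.arr .alive' v ≠ 0 ↔ M.alive (i + 1) v
  rad : ∀ j < M.n + M.n, h.arr .rad j = M.radix i j
  rad' : ∀ j < M.n + M.n, h.arr .rad' j = M.radix (i + 1) j

namespace Stmt

open Expr (const var add sub rd inp cond)

/-- The parts of the store on which a step depends are not changed. -/
def keepsStep (p : Stmt) : Bool :=
  !(!p.keeps || p.writesVar .row || p.writesVar .Na || p.writesVar .Nb || p.writesArr .alive ||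
    p.writesArr .alive' || p.writesArr .rad || p.writesArr .rad')

end Stmt

theorem Model.StepContext.frame {M : Model} {h h' : Store} {i : ℕ} {p : Stmt}
    (K : M.StepContext h i) (F : Stmt.Frame p h h') (hp : p.keepsStep = true) :
    M.StepContext h' i := by
  simp only [Stmt.keepsStep, Bool.not_eq_true', Bool.or_eq_false_iff, Bool.not_eq_false'] at hp
  obtain ⟨⟨⟨⟨⟨⟨⟨h1, h2⟩, h3⟩, h4⟩, h5⟩, h6⟩, h7⟩, h8⟩ := hp
  exact ⟨K.link.frame F h1, K.lt, by rw [F.var _ h2, K.row], by rw [F.var _ h3, K.Na],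
    by rw [F.var _ h4, K.Nb], by rw [F.arr _ h5]; exact K.alive, by rw [F.arr _ h6]; exact K.alive',
    by rw [F.arr _ h7]; exact K.rad, by rw [F.arr _ h8]; exact K.rad'⟩

theorem Model.radix_pos (M : Model) (i j : ℕ) : 0 < M.radix i j := by
  unfold Model.radix; split_ifs <;> omega

open Classical in
/-- The value of a successor state `b` with value `V b`, as seen from the state `z`. -/
noncomputable def Model.option (M : Model) (i : ℕ) (V : ℕ → ℕ) (z : ℕ → ℕ) (b : ℕ) : ℕ :=
  if M.Compatible i z (mixedDigit (M.radix (i + 1)) b) then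
    V b + M.gain i (M.Active i z (mixedDigit (M.radix (i + 1)) b)) else 0

theorem Model.value_succ (M : Model) (q m : ℕ) :
    M.value (q + 1) m = (Finset.range (M.states (M.T - (q + 1) + 1))).sup
      (M.option (M.T - (q + 1)) (M.value q) (mixedDigit (M.radix (M.T - (q + 1))) m)) := rfl

namespace Stmt

open Expr (const var add sub rd inp cond)

/-- Consider the successor state `b`, and go to the next one. -/
def examine : Stmt :=
  seq check (seq
    (ite (var .ok) (seq addGain (ite (.lt (var .best) (var .g)) (asg .best (var .g)) skip)) skip)
    (incr .dig' .rad'))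

theorem spec_examine {M : Model} {h : Store} {i : ℕ} (K : M.StepContext h i) {z : ℕ → ℕ}
    (hz : ∀ j < M.n + M.n, h.arr .dig j = z j)
    (hz' : ∀ j < M.n + M.n, h.arr .dig' j = mixedDigit (M.radix (i + 1)) (h.var .b) j) :
    examine.Spec h (1000 * (M.n + 1) ^ 2) fun h' =>
      h'.var .best = max (h.var .best) (M.option i (h.arr .val) z (h.var .b)) ∧
      ∀ j < M.n + M.n, h'.arr .dig' j = mixedDigit (M.radix (i + 1)) (h.var .b + 1) j := by
  refine (Spec.seq (spec_check K.link K.alive K.alive' hz hz') (Q' := fun h' =>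
      h'.var .best = max (h.var .best) (M.option i (h.arr .val) z (h.var .b)) ∧
      ∀ j < M.n + M.n, h'.arr .dig' j = mixedDigit (M.radix (i + 1)) (h.var .b + 1) j)
      (b' := (3 + ((22 + M.n * (M.n * 109 + 15) + 30) + 1)) + (12 + (M.n + M.n) * 109))
      ?_).mono (by ring_nf; omega) fun _ _ h => h
  rintro h₁ F₁ ⟨h1, h2⟩
  have K₁ := K.frame F₁ rfl
  refine Spec.seq (Q := fun h' =>
      h'.var .best = max (h.var .best) (M.option i (h.arr .val) z (h.var .b)))
    (spec_ite (e := .var .ok) ?_ ?_) ?_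
  · intro hok
    have hc := h1.1 hok
    refine Spec.seq (spec_addGain K₁.link K₁.lt K₁.row (h2 hc)) ?_
    intro h₂ F₂ hg
    refine spec_of_loopFree rfl (Nat.le_of_ble_eq_true rfl) ?_
    have hb : h₂.var .best = h.var .best := (F₂.var _ rfl).trans (F₁.var _ rfl)
    rw [F₁.arr .val rfl, F₁.var .b rfl] at hg
    simp only [Model.option, if_pos hc, ← hg, run, Expr.eval, hb]
    by_cases hlt : h.var .best < h₂.var .g
    · have : h₂.var .g - h.var .best ≠ 0 := by omega
      simp [this, hlt.le]
    · have : h₂.var .g - h.var .best = 0 := by omega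
      simp [this, not_lt.1 hlt, hb]
  -- An incompatible successor counts as 0, so skipping it does not change the maximum.
  · intro hok
    have hc : ¬ M.Compatible i z (mixedDigit (M.radix (i + 1)) (h.var .b)) := by
      rw [← h1]; simpa [Expr.eval] using hok
    refine spec_skip ?_
    simp [Model.option, hc, F₁.var .best rfl]
  · intro h₂ F₂ hbest
    have e1 : h₂.arr .dig' = h.arr .dig' := (F₂.arr _ rfl).trans (F₁.arr _ rfl)
    have e2 : h₂.arr .rad' = h.arr .rad' := (F₂.arr _ rfl).trans (F₁.arr _ rfl)
    have e3 : h₂.var .n = M.n := ((F₂.var _ rfl).trans (F₁.var _ rfl)).trans K.link.n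
    have := spec_incr (D := .dig') (R := .rad') (h := h₂) (by decide) (M.radix_pos (i + 1))
      (m := h.var .b) (by rw [e2, e3]; exact K.rad') (by rw [e1, e3]; exact hz')
    rw [e3] at this
    exact this.mono le_rfl fun h₃ F₃ h => ⟨(F₃.var _ rfl).trans hbest, h⟩

/-- Compute in `best` the value of the state with the digits in `dig`. -/
def search : Stmt := seq (asg .best (const 0)) (seq (clear .dig') (loop .b (var .Nb) examine))

theorem spec_search {M : Model} {h : Store} {i : ℕ} (K : M.StepContext h i) {z : ℕ → ℕ}
    (hz : ∀ j < M.n + M.n, h.arr .dig j = z j) :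
    search.Spec h (20 + M.n * 40 + M.states (i + 1) * (1000 * (M.n + 1) ^ 2 + 9)) fun h' =>
      h'.var .best = (Finset.range (M.states (i + 1))).sup (M.option i (h.arr .val) z) := by
  refine (Spec.seq (b := 3) (Q := fun h' => h' = h.setVar .best 0) (spec_asg (e := const 0) rfl)
    (b' := (9 + (M.n + M.n) * 20) + (6 + M.states (i + 1) * (1000 * (M.n + 1) ^ 2 + 9)))
    (Q' := fun h' => h'.var .best = (Finset.range (M.states (i + 1))).sup (M.option i (h.arr .val) z))
    ?_).mono (by omega) fun _ _ h => h
  rintro _ F₁ rfl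
  have K₁ : M.StepContext (h.setVar .best 0) i := K.frame F₁ rfl
  have hcl := spec_clear .dig' (h.setVar .best 0)
  rw [K₁.link.n] at hcl
  refine Spec.seq hcl ?_
  intro h₂ F₂ hd
  have K₂ := K₁.frame F₂ rfl
  have ev : h₂.arr .val = h.arr .val := by rw [F₂.arr _ rfl]; rfl
  have hz₂ : ∀ j < M.n + M.n, h₂.arr .dig j = z j := by rw [F₂.arr _ rfl]; exact hz
  refine (spec_loop (N := M.states (i + 1)) (b := 1000 * (M.n + 1) ^ 2) rfl
    (by simp [Expr.eval, K₂.Nb]) (fun b h' =>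
      h'.var .best = (Finset.range b).sup (M.option i (h.arr .val) z) ∧
      ∀ j < M.n + M.n, h'.arr .dig' j = mixedDigit (M.radix (i + 1)) b j) ?_ ?_).mono
    (by simp [Expr.size]) fun _ _ h => h.1
  · refine ⟨?_, fun j hj => ?_⟩
    · simp [F₂.var .best rfl]
    · rw [mixedDigit_zero]; exact hd j hj
  · rintro b hb h₃ F₃ hbv ⟨hI1, hI2⟩
    have K₃ := K₂.frame F₃ rfl
    have ev₃ : h₃.arr .val = h.arr .val := by rw [F₃.arr _ rfl, ev]
    have hz₃ : ∀ j < M.n + M.n, h₃.arr .dig j = z j := by rw [F₃.arr _ rfl]; exact hz₂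
    refine (spec_examine K₃ hz₃ (by rw [hbv]; exact hI2)).mono le_rfl ?_
    rintro h₄ F₄ ⟨h1, h2⟩
    rw [hbv, ev₃, hI1] at h1
    rw [hbv] at h2
    refine ⟨?_, h2⟩
    rw [Store.setVar_var, if_neg (by decide), h1, Finset.range_add_one, Finset.sup_insert]
    exact max_comm _ _

/-- Compute the values of all states at a boundary from those at the next one. -/
def tabulate : Stmt :=
  seq (clear .dig) (seq
    (loop .a (var .Na) (seq search (seq (sto .new (var .a) (var .best)) (incr .dig .rad))))
    (loop .a (var .Na) (sto .val (var .a) (rd .new (var .a)))))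

/-- The new values are collected in `new` and copied at the end, because each of them depends on the
whole old table. -/
theorem spec_tabulate {M : Model} {h : Store} {i : ℕ} (K : M.StepContext h i) :
    tabulate.Spec h (21 + M.n * 40 + M.states i *
      (100 + M.n * 300 + M.states (i + 1) * (1000 * (M.n + 1) ^ 2 + 9))) fun h' =>
      ∀ m < M.states i, h'.arr .val m = (Finset.range (M.states (i + 1))).sup
        (M.option i (h.arr .val) (mixedDigit (M.radix i) m)) := by
  have hcl := spec_clear .dig h
  rw [K.link.n] at hcl
  refine (hcl.seq (b' := (6 + M.states i *
      ((20 + M.n * 40 + M.states (i + 1) * (1000 * (M.n + 1) ^ 2 + 9) +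
        (12 + (12 + (M.n + M.n) * 109))) + 9)) + (6 + M.states i * (20 + 9)))
    (Q' := fun h' => ∀ m < M.states i, h'.arr .val m = (Finset.range (M.states (i + 1))).sup
        (M.option i (h.arr .val) (mixedDigit (M.radix i) m))) ?_).mono ?_ fun _ _ h => h
  swap
  · ring_nf; omega
  intro h₁ F₁ hd
  have K₁ := K.frame F₁ rfl
  have ev₁ : h₁.arr .val = h.arr .val := F₁.arr _ rfl
  refine Spec.seq (Q := fun h' => ∀ m < M.states i, h'.arr .new m =
    (Finset.range (M.states (i + 1))).sup (M.option i (h.arr .val) (mixedDigit (M.radix i) m)))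
    ((spec_loop rfl (N := M.states i) (b := 20 + M.n * 40 + M.states (i + 1) *
      (1000 * (M.n + 1) ^ 2 + 9) + (12 + (12 + (M.n + M.n) * 109))) (by simp [Expr.eval, K₁.Na]) (fun a h' =>
      (∀ m < a, h'.arr .new m = (Finset.range (M.states (i + 1))).sup
        (M.option i (h.arr .val) (mixedDigit (M.radix i) m))) ∧
      ∀ j < M.n + M.n, h'.arr .dig j = mixedDigit (M.radix i) a j) ?_ ?_).mono
      (by simp [Expr.size]) fun _ _ h => h.1) ?_
  · exact ⟨by simp, fun j hj => by rw [mixedDigit_zero]; exact hd j hj⟩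
  · rintro a ha h₂ F₂ hav ⟨hI1, hI2⟩
    have K₂ := K₁.frame F₂ rfl
    have ev₂ : h₂.arr .val = h.arr .val := by rw [F₂.arr _ rfl, ev₁]
    refine (spec_search K₂ hI2).seq ?_
    intro h₃ F₃ hbest
    rw [ev₂] at hbest
    have hn₃ : h₃.arr .new = h₂.arr .new := F₃.arr _ rfl
    have ha₃ : h₃.var .a = a := (F₃.var _ rfl).trans hav
    refine Spec.seq (b := 12) (Q := fun h' => h' = h₃.setArr .new a (h₃.var .best))
      (spec_sto (e := .var .a) (f := .var .best) (by simp [Expr.eval, ha₃])) ?_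
    rintro _ F₄ rfl
    have K₃ := K₂.frame F₃ rfl
    have hdig : h₃.arr .dig = h₂.arr .dig := F₃.arr _ rfl
    have := spec_incr (D := .dig) (R := .rad) (h := h₃.setArr .new a (h₃.var .best)) (by decide)
      (M.radix_pos i) (m := a) (by simpa [K₃.link.n] using K₃.rad)
      (by simpa [K₃.link.n, hdig] using hI2)
    rw [Store.setArr_var, K₃.link.n] at this
    refine this.mono le_rfl fun h₄ F₅ hd => ⟨fun m hm => ?_, hd⟩
    rw [Store.setVar_arr, F₅.arr .new rfl, Store.setArr_arr, hn₃]
    by_cases hma : m = a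
    · rw [if_pos ⟨rfl, hma⟩, hbest, hma]
    · rw [if_neg (by tauto)]; exact hI1 m (by omega)
  · intro h₂ F₂ hnew
    have K₂ := K₁.frame F₂ rfl
    refine (spec_loop rfl (N := M.states i) (b := 20) (by simp [Expr.eval, K₂.Na]) (fun a h' =>
      ∀ m < a, h'.arr .val m = (Finset.range (M.states (i + 1))).sup
        (M.option i (h.arr .val) (mixedDigit (M.radix i) m))) (by simp) ?_).mono
      (by simp [Expr.size]) fun _ _ h => h
    intro a ha h₃ F₃ hav hI
    refine spec_of_loopFree rfl (Nat.le_of_ble_eq_true rfl) ?_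
    intro m hm
    have hn₃ : h₃.arr .new = h₂.arr .new := F₃.arr _ rfl
    simp only [run, Expr.eval, hav, hn₃, Store.setVar_arr, Store.setArr_arr, true_and]
    by_cases hma : m = a
    · rw [if_pos hma, hma, hnew a ha]
    · rw [if_neg hma]; exact hI m (by omega)

/-- Compute the states at the boundary `i + 1` and at the boundary `i`. -/
def prepare : Stmt :=
  seq (asg .p (add (var .i) (const 1))) (seq (radices .alive' .rad') (seq (product .rad')
    (seq (asg .Nb (var .g)) (seq (asg .p (var .i)) (seq (radices .alive .rad) (seq (product .rad)
      (asg .Na (var .g))))))))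

theorem spec_prepare {M : Model} (hM : ∀ i j, M.radix i j ≤ M.T + 1) {h : Store} (L : M.Link h)
    {i : ℕ} (hi : h.var .i = i) (hiT : i < M.T) (hrow : h.var .row = i * (M.n * M.n)) :
    prepare.Spec h (100 + M.n * 800 + M.n * M.T * 40) fun h' => M.StepContext h' i := by
  refine (Spec.seq (b := 6) (Q := fun h' => h' = h.setVar .p (i + 1))
    (spec_asg (e := add (var .i) (const 1)) (by simp [Expr.eval, hi]))
    (b' := (6 + M.n * 309) + ((12 + (M.n + M.n) * ((M.T + 1) * 10 + 30)) + (4 + (4 + ((6 + M.n * 309)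
      + ((12 + (M.n + M.n) * ((M.T + 1) * 10 + 30)) + 4))))))
    (Q' := fun h' => M.StepContext h' i) ?_).mono (by ring_nf; omega) fun _ _ h => h
  rintro _ F₁ rfl
  have L₁ : M.Link (h.setVar .p (i + 1)) := L.frame F₁ rfl
  refine (spec_radices (A := .alive') (R := .rad') (by decide) (by decide) (by decide) (by decide)
    (by decide) L₁ (i := i + 1) hiT (by simp)).seq ?_
  rintro h₂ F₂ ⟨ha₂, hr₂⟩
  have L₂ := L₁.frame F₂ rfl
  have hp₂ := spec_product (R := .rad') (h := h₂) (f := M.radix (i + 1)) (b := M.T + 1)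
    (by rw [L₂.n]; exact hr₂) fun j _ => hM _ j
  rw [L₂.n] at hp₂
  refine hp₂.seq ?_
  intro h₃ F₃ hg₃
  have L₃ := L₂.frame F₃ rfl
  refine Spec.seq (b := 4) (Q := fun h' => h' = h₃.setVar .Nb (M.states (i + 1)))
    (spec_asg (e := var .g) (by simp [Expr.eval, hg₃, Model.states])) ?_
  rintro _ F₄ rfl
  have hi₄ : (h₃.setVar .Nb (M.states (i + 1))).var .i = i := by
    rw [F₄.var _ rfl, F₃.var _ rfl, F₂.var _ rfl, F₁.var _ rfl, hi]
  have hrow₄ : (h₃.setVar .Nb (M.states (i + 1))).var .row = i * (M.n * M.n) := by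
    rw [F₄.var _ rfl, F₃.var _ rfl, F₂.var _ rfl, F₁.var _ rfl, hrow]
  have ha₄ : (h₃.setVar .Nb (M.states (i + 1))).arr .alive' = h₂.arr .alive' := by
    rw [F₄.arr _ rfl, F₃.arr _ rfl]
  have hr₄ : (h₃.setVar .Nb (M.states (i + 1))).arr .rad' = h₂.arr .rad' := by
    rw [F₄.arr _ rfl, F₃.arr _ rfl]
  have L₄ := L₃.frame F₄ rfl
  have hNb : (h₃.setVar .Nb (M.states (i + 1))).var .Nb = M.states (i + 1) := by simp
  generalize h₃.setVar .Nb (M.states (i + 1)) = h₄ at *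
  refine Spec.seq (b := 4) (Q := fun h' => h' = h₄.setVar .p i)
    (spec_asg (e := var .i) (by simp [Expr.eval, hi₄])) ?_
  rintro _ F₅ rfl
  have L₅ := L₄.frame F₅ rfl
  refine (spec_radices (A := .alive) (R := .rad) (by decide) (by decide) (by decide) (by decide)
    (by decide) L₅ (i := i) hiT.le (by simp)).seq ?_
  rintro h₆ F₆ ⟨ha₆, hr₆⟩
  have L₆ := L₅.frame F₆ rfl
  have hp₆ := spec_product (R := .rad) (h := h₆) (f := M.radix i) (b := M.T + 1)
    (by rw [L₆.n]; exact hr₆) fun j _ => hM _ j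
  rw [L₆.n] at hp₆
  refine hp₆.seq ?_
  intro h₇ F₇ hg₇
  have L₇ := L₆.frame F₇ rfl
  refine Spec.mono (Q := fun h' => h' = h₇.setVar .Na (M.states i)) (b := 4)
    (spec_asg (e := var .g) (by simp [Expr.eval, hg₇, Model.states])) le_rfl ?_
  rintro _ F₈ rfl
  refine ⟨L₇.frame F₈ rfl, hiT, ?_, by simp, ?_, ?_, ?_, ?_, ?_⟩
  · rw [F₈.var _ rfl, F₇.var _ rfl, F₆.var _ rfl, F₅.var _ rfl, hrow₄]
  · rw [F₈.var _ rfl, F₇.var _ rfl, F₆.var _ rfl, F₅.var _ rfl, hNb]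
  · rw [F₈.arr _ rfl, F₇.arr _ rfl]; exact ha₆
  · rw [F₈.arr _ rfl, F₇.arr _ rfl, F₆.arr _ rfl, F₅.arr _ rfl, ha₄]; exact ha₂
  · rw [F₈.arr _ rfl, F₇.arr _ rfl]; exact hr₆
  · rw [F₈.arr _ rfl, F₇.arr _ rfl, F₆.arr _ rfl, F₅.arr _ rfl, hr₄]; exact hr₂

/-- The loop over all times, from the last one to the first one. -/
def sweep : Stmt :=
  seq (asg .i (var .T)) (rep (var .T) (seq (asg .i (sub (var .i) (const 1)))
    (seq (asg .row (sub (var .row) (var .n2))) (seq prepare tabulate))))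

/-- The zero-initialised table is the correct one at boundary `T`. The address `row` starts at the
end of the input and drops by `n²` per step. -/
theorem spec_sweep {M : Model} (hM : ∀ i j, M.radix i j ≤ M.T + 1) {h : Store} (L : M.Link h)
    (hrow : h.var .row = M.T * (M.n * M.n)) (hval : ∀ m, h.arr .val m = 0) {s : ℕ}
    (hs : ∀ i, M.states i ≤ s) :
    sweep.Spec h (7 + M.T * (140 + M.n * 840 + M.n * M.T * 40 +
      s * (100 + M.n * 300 + s * (1000 * (M.n + 1) ^ 2 + 9)))) fun h' =>
      ∀ m < M.states 0, h'.arr .val m = M.value M.T m := by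
  refine (Spec.seq (b := 4) (Q := fun h' => h' = h.setVar .i M.T)
    (spec_asg (e := var .T) (by simp [Expr.eval, L.T])) (b' := 3 + M.T * ((137 + M.n * 840 +
      M.n * M.T * 40 + s * (100 + M.n * 300 + s * (1000 * (M.n + 1) ^ 2 + 9))) + 3))
    (Q' := fun h' => ∀ m < M.states 0, h'.arr .val m = M.value M.T m)
    ?_).mono (by ring_nf; omega) fun _ _ h => h
  rintro _ F₁ rfl
  have L₁ : M.Link (h.setVar .i M.T) := L.frame F₁ rfl
  refine (spec_rep (e := var .T) (N := M.T) (b := 137 + M.n * 840 + M.n * M.T * 40 +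
    s * (100 + M.n * 300 + s * (1000 * (M.n + 1) ^ 2 + 9))) L₁.T (fun q h' => h'.var .i = M.T - q ∧
    h'.var .row = (M.T - q) * (M.n * M.n) ∧ ∀ m < M.states (M.T - q), h'.arr .val m = M.value q m)
    ⟨by simp, by simp [hrow], fun m _ => by simp [hval, Model.value]⟩
    ?_).mono (by simp [Expr.size]) ?_
  swap
  · rintro h' - ⟨-, -, h⟩
    simpa using h
  rintro q hq h₂ F₂ ⟨hi, hr, hv⟩
  obtain ⟨i, hiq⟩ : ∃ i, M.T - (q + 1) = i := ⟨_, rfl⟩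
  have hiq' : M.T - q = i + 1 := by omega
  have hiT : i < M.T := by omega
  rw [hiq]
  rw [hiq'] at hi hr hv
  have L₂ := L₁.frame F₂ rfl
  refine (Spec.seq (b := 6) (Q := fun h' => h' = h₂.setVar .i i)
    (spec_asg (e := sub (var .i) (const 1)) (by simp [Expr.eval, hi]))
    (b' := 7 + ((100 + M.n * 800 + M.n * M.T * 40) + (21 + M.n * 40 + M.states i *
      (100 + M.n * 300 + M.states (i + 1) * (1000 * (M.n + 1) ^ 2 + 9)))))
    (Q' := fun h' => h'.var .i = i ∧ h'.var .row = i * (M.n * M.n) ∧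
      ∀ m < M.states i, h'.arr .val m = M.value (q + 1) m) ?_).mono ?_ fun _ _ h => h
  swap
  · have h1 := Nat.mul_le_mul (hs i) (Nat.add_le_add_left
      (Nat.mul_le_mul_right (1000 * (M.n + 1) ^ 2 + 9) (hs (i + 1))) (100 + M.n * 300))
    omega
  rintro _ F₃ rfl
  have L₃ := L₂.frame F₃ rfl
  refine Spec.seq (b := 7) (Q := fun h' => h' = (h₂.setVar .i i).setVar .row (i * (M.n * M.n)))
    (spec_asg (e := sub (var .row) (var .n2)) (by
      simp [Expr.eval, hr, L₂.n2, Nat.add_mul])) ?_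
  rintro _ F₄ rfl
  have L₄ := L₃.frame F₄ rfl
  refine (spec_prepare hM L₄ (i := i) (by simp) hiT (by simp)).seq ?_
  intro h₅ F₅ K
  have ev : h₅.arr .val = h₂.arr .val := by rw [F₅.arr _ rfl]; rfl
  refine (spec_tabulate K).mono le_rfl ?_
  intro h₆ F₆ hT
  refine ⟨?_, ?_, fun m hm => ?_⟩
  · rw [F₆.var _ rfl, F₅.var _ rfl]; simp
  · rw [F₆.var _ rfl, F₅.var _ rfl]; simp
  · rw [hT m hm, Model.value_succ, hiq]
    refine Finset.sup_congr rfl fun b hb => ?_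
    rw [Model.option, Model.option, ev, hv b (Finset.mem_range.1 hb)]

end Stmt

/-! ### The number of stored vertices -/

/-- If the `x`-th entry were less than `h`, so would be all later ones, leaving at most `x - 1`
entries that are at least `h`. -/
theorem List.le_getD_of_le_countP {L : List ℕ} (hL : L.Pairwise (fun a b => b ≤ a)) {h x : ℕ}
    (hx : 1 ≤ x) (hc : x ≤ L.countP (fun a => decide (h ≤ a))) : h ≤ L.getD (x - 1) 0 := by
  have hlen : x ≤ L.length := hc.trans List.countP_le_length
  have hlt : x - 1 < L.length := by omega
  rw [List.getD_eq_getElem _ _ hlt]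
  by_contra hlt'
  rw [← List.take_append_drop (x - 1) L, List.countP_append] at hc
  have h1 : (L.take (x - 1)).countP (fun a => decide (h ≤ a)) ≤ x - 1 :=
    List.countP_le_length.trans (List.length_take_le _ _)
  have h2 : (L.drop (x - 1)).countP (fun a => decide (h ≤ a)) = 0 := by
    rw [List.countP_eq_zero]
    intro a ha
    rw [List.drop_eq_getElem_cons hlt] at ha
    have hp : (L.drop (x - 1)).Pairwise (fun a b => b ≤ a) :=
      hL.sublist (List.drop_sublist _ _)
    rw [List.drop_eq_getElem_cons hlt, List.pairwise_cons] at hp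
    rcases List.mem_cons.1 ha with rfl | ha
    · simpa using hlt'
    · have := hp.1 a ha
      simp only [decide_eq_true_eq]
      omega
  omega

namespace TemporalGraph

variable {V : Type*} [Fintype V] {T : ℕ}

theorem le_vimw (G : TemporalGraph V T) {h x : ℕ} (hx : 1 ≤ x)
    (hc : x ≤ (Finset.univ.filter fun j => h ≤ (G.bag j).card).card) : h ≤ G.vimw x := by
  unfold vimw sortedBagSizes
  refine List.le_getD_of_le_countP ?_ hx (hc.trans_eq ?_)
  · refine (List.pairwise_mergeSort (le := fun a b => decide (b ≤ a)) ?_ ?_ _).imp ?_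
    · intro a b c; simp; omega
    · intro a b; simp; omega
    · intro a b; simp
  · rw [(List.mergeSort_perm _ _).countP_eq, List.ofFn_eq_map, List.countP_map,
      List.countP_eq_length_filter, Finset.card_def, Finset.filter_val]
    simp [Finset.univ, Fintype.elems, Multiset.filter_coe, Function.comp_def]

theorem card_le_two_mul_vimw (G : TemporalGraph V T) {x : ℕ} (hx : 1 ≤ x) (A : Finset V) (i : Fin T)
    (f e : V → ℕ) (hf : ∀ v ∈ A, f v ≤ i) (he : ∀ v ∈ A, (i : ℕ) ≤ e v) (heT : ∀ v ∈ A, e v < T)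
    (hlen : ∀ v ∈ A, f v + x ≤ e v + 1)
    (hbag : ∀ v ∈ A, ∀ j : Fin T, f v ≤ j → (j : ℕ) ≤ e v → v ∈ G.bag j) :
    A.card ≤ 2 * G.vimw x := by
  obtain ⟨h, hh⟩ : ∃ h, h = (A.card + 1) / 2 := ⟨_, rfl⟩
  rcases Nat.eq_zero_or_pos A.card with h0 | h0
  · omega
  suffices h ≤ G.vimw x by omega
  apply G.le_vimw hx
  -- Every vertex counted here lies in the last bag of size less than `h` up to time `i`.
  have hl : (A.filter fun v => ∃ j : Fin T, j ≤ i ∧ (G.bag j).card < h ∧ f v ≤ j).card < h := by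
    set B := Finset.univ.filter fun j : Fin T => j ≤ i ∧ (G.bag j).card < h with hB
    by_cases hne : B.Nonempty
    · have hm := Finset.mem_filter.1 (B.max'_mem hne)
      refine lt_of_le_of_lt (Finset.card_le_card ?_) hm.2.2
      intro v hv
      rw [Finset.mem_filter] at hv
      obtain ⟨hv, j, hji, hjb, hfj⟩ := hv
      have hjm : j ≤ B.max' hne := B.le_max' j (by rw [hB, Finset.mem_filter]; simp [hji, hjb])
      have hjm' : (j : ℕ) ≤ (B.max' hne : Fin T) := hjm
      have hmi : ((B.max' hne : Fin T) : ℕ) ≤ i := hm.2.1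
      have := he v hv
      exact hbag v hv _ (by omega) (by omega)
    · rw [Finset.filter_false_of_mem]
      · simp; omega
      · rintro v hv ⟨j, hji, hjb, hfj⟩
        exact hne ⟨j, by rw [hB, Finset.mem_filter]; simp [hji, hjb]⟩
  have hr : (A.filter fun v => ∃ j : Fin T, i ≤ j ∧ (G.bag j).card < h ∧ j ≤ e v).card < h := by
    set B := Finset.univ.filter fun j : Fin T => i ≤ j ∧ (G.bag j).card < h with hB
    by_cases hne : B.Nonempty
    · have hm := Finset.mem_filter.1 (B.min'_mem hne)
      refine lt_of_le_of_lt (Finset.card_le_card ?_) hm.2.2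
      intro v hv
      rw [Finset.mem_filter] at hv
      obtain ⟨hv, j, hji, hjb, hfj⟩ := hv
      have hjm : B.min' hne ≤ j := B.min'_le j (by rw [hB, Finset.mem_filter]; simp [hji, hjb])
      have hjm' : ((B.min' hne : Fin T) : ℕ) ≤ j := hjm
      have hmi : (i : ℕ) ≤ (B.min' hne : Fin T) := hm.2.1
      have := hf v hv
      exact hbag v hv _ (by omega) (by omega)
    · rw [Finset.filter_false_of_mem]
      · simp; omega
      · rintro v hv ⟨j, hji, hjb, hfj⟩
        exact hne ⟨j, by rw [hB, Finset.mem_filter]; simp [hji, hjb]⟩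
  classical
  -- Two sets of size at most `h - 1` cannot exhaust `A`, since `|A| ≥ 2h - 1`.
  obtain ⟨v, hv, hnl⟩ : ∃ v ∈ A, v ∉ (A.filter fun v => ∃ j : Fin T, j ≤ i ∧ (G.bag j).card < h ∧
      f v ≤ j) ∪ (A.filter fun v => ∃ j : Fin T, i ≤ j ∧ (G.bag j).card < h ∧ j ≤ e v) := by
    by_contra hcon
    push Not at hcon
    have := Finset.card_le_card (show A ⊆ _ from hcon)
    have := this.trans (Finset.card_union_le _ _)
    omega
  simp only [Finset.mem_union, Finset.mem_filter, hv, true_and, not_or, not_exists, not_and] at hnl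
  have hfe : f v ≤ e v := (hf v hv).trans (he v hv)
  have hsub : (Finset.Icc (⟨f v, by have := heT v hv; omega⟩ : Fin T) ⟨e v, heT v hv⟩) ⊆
      Finset.univ.filter fun j => h ≤ (G.bag j).card := by
    intro j hj
    rw [Finset.mem_Icc, Fin.le_def, Fin.le_def] at hj
    rw [Finset.mem_filter]
    refine ⟨Finset.mem_univ _, ?_⟩
    by_contra hlt
    rcases le_total j i with hji | hji
    · exact hnl.1 j hji (by omega) hj.1
    · exact hnl.2 j hji (by omega) hj.2
  refine le_trans ?_ (Finset.card_le_card hsub)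
  rw [Fin.card_Icc]
  have := hlen v hv
  simp only
  omega

end TemporalGraph

/-! ### The lifetimes of the vertices -/

/-- `T - s v` is the least and `e v` is the largest `i` with `E i v`; both `s v` and `e v` are `0`
if there is no such `i`. -/
structure Recorded (T : ℕ) (E : ℕ → ℕ → Prop) (s e : ℕ → ℕ) : Prop where
  le : ∀ i v, E i v → T - i ≤ s v ∧ i ≤ e v
  start : ∀ v, s v ≠ 0 → ∃ i < T, E i v ∧ s v = T - i
  last : ∀ v, e v ≠ 0 → ∃ i < T, E i v ∧ e v = i

/-- Entries arrive in order of time, so the first time is written once and the last one always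
overwritten. Storing `T - i`, which is positive, lets 0 mean that no edge has been seen. -/
theorem Recorded.insert {T : ℕ} {E : ℕ → ℕ → Prop} {s e : ℕ → ℕ} (R : Recorded T E s e) {i v : ℕ}
    (hi : i < T) (hE : ∀ j w, E j w → j ≤ i) :
    Recorded T (fun j w => E j w ∨ (j = i ∧ w = v))
      (fun w => if w = v then if s v ≠ 0 then s v else T - i else s w)
      (fun w => if w = v then i else e w) where
  le := by
    rintro j w (h | ⟨rfl, rfl⟩)
    · have h1 := R.le j w h
      have h2 := hE j w h
      by_cases hw : w = v
      · subst hw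
        rw [if_pos rfl, if_pos rfl, if_pos (by omega)]
        exact ⟨h1.1, h2⟩
      · rwa [if_neg hw, if_neg hw]
    · rw [if_pos rfl, if_pos rfl]
      refine ⟨?_, le_rfl⟩
      split_ifs with h0
      · obtain ⟨i₀, _, h1, h2⟩ := R.start w h0
        have := hE i₀ w h1
        omega
      · exact le_rfl
  start := by
    intro w hw
    by_cases hwv : w = v
    · subst hwv
      rw [if_pos rfl] at hw ⊢
      by_cases h0 : s w ≠ 0
      · obtain ⟨i₀, h1, h2, h3⟩ := R.start w h0
        exact ⟨i₀, h1, Or.inl h2, by rw [if_pos h0, h3]⟩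
      · exact ⟨i, hi, Or.inr ⟨rfl, rfl⟩, by rw [if_neg h0]⟩
    · rw [if_neg hwv] at hw ⊢
      obtain ⟨i₀, h1, h2, h3⟩ := R.start w hw
      exact ⟨i₀, h1, Or.inl h2, h3⟩
  last := by
    intro w hw
    by_cases hwv : w = v
    · exact ⟨i, hi, Or.inr ⟨rfl, hwv⟩, by rw [if_pos hwv]⟩
    · rw [if_neg hwv] at hw ⊢
      obtain ⟨i₀, h1, h2, h3⟩ := R.last w hw
      exact ⟨i₀, h1, Or.inl h2, h3⟩

theorem index_div {n i v u : ℕ} (hu : u < n) : ((i * n + v) * n + u) / n = i * n + v := by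
  rw [mul_comm, Nat.mul_add_div (Nat.zero_lt_of_lt hu), Nat.div_eq_of_lt hu, add_zero]

theorem index_div_div {n i v u : ℕ} (hv : v < n) (hu : u < n) :
    ((i * n + v) * n + u) / n / n = i := by
  rw [index_div hu, mul_comm, Nat.mul_add_div (Nat.zero_lt_of_lt hu), Nat.div_eq_of_lt hv, add_zero]

theorem index_injective {n i v u i' v' u' : ℕ} (hv : v < n) (hu : u < n) (hv' : v' < n)
    (hu' : u' < n) (h : (i * n + v) * n + u = (i' * n + v') * n + u') :
    i = i' ∧ v = v' ∧ u = u' := by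
  have h1 : i = i' := by rw [← index_div_div (i := i) hv hu, h, index_div_div hv' hu']
  have h2 : i * n + v = i' * n + v' := by rw [← index_div (i := i) hu, h, index_div hu']
  subst h1
  have h3 : v = v' := by omega
  subst h3
  exact ⟨rfl, rfl, by omega⟩

/-- One of the first `r` entries of the adjacency matrices shows an edge at `v` at time `i`. -/
def SeenBefore (n : ℕ) (inp : ℕ → ℕ) (r i v : ℕ) : Prop :=
  v < n ∧ ∃ u < n, (i * n + v) * n + u < r ∧ inp ((i * n + v) * n + u) ≠ 0

theorem SeenBefore.le {n i v u j w : ℕ} {inp : ℕ → ℕ} (hv : v < n) (hu : u < n)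
    (h : SeenBefore n inp ((i * n + v) * n + u) j w) : j ≤ i := by
  obtain ⟨hw, x, hx, h, -⟩ := h
  rw [← index_div_div (i := j) hw hx, ← index_div_div (i := i) hv hu]
  exact Nat.div_le_div_right (Nat.div_le_div_right h.le)

theorem seenBefore_succ {n i v u : ℕ} {inp : ℕ → ℕ} (hv : v < n) (hu : u < n) (j w : ℕ) :
    SeenBefore n inp ((i * n + v) * n + u + 1) j w ↔
      SeenBefore n inp ((i * n + v) * n + u) j w ∨
        (inp ((i * n + v) * n + u) ≠ 0 ∧ j = i ∧ w = v) := by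
  constructor
  · rintro ⟨hw, x, hx, h, h0⟩
    rcases Nat.lt_succ_iff_lt_or_eq.1 h with h | h
    · exact Or.inl ⟨hw, x, hx, h, h0⟩
    · obtain ⟨rfl, rfl, rfl⟩ := index_injective hw hx hv hu h
      exact Or.inr ⟨h0, rfl, rfl⟩
  · rintro (⟨hw, x, hx, h, h0⟩ | ⟨h0, rfl, rfl⟩)
    · exact ⟨hw, x, hx, h.trans (Nat.lt_succ_self _), h0⟩
    · exact ⟨hv, u, hu, Nat.lt_succ_self _, h0⟩

namespace Stmt

open Expr (const var add sub rd inp cond)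

/-- Consider one entry of the adjacency matrices. -/
def record : Stmt :=
  seq (ite (inp (var .row))
      (seq (sto .start (var .v) (cond (rd .start (var .v)) (rd .start (var .v))
          (sub (var .T) (var .i))))
        (sto .last (var .v) (var .i)))
      skip)
    (asg .row (add (var .row) (const 1)))

/-- Compute the lifetimes of the vertices. -/
def lifetimes : Stmt :=
  seq (asg .row (const 0)) (loop .i (var .T) (loop .v (var .n) (loop .u (var .n) record)))

theorem spec_lifetimes {h : Store} {n T : ℕ} (hn : h.var .n = n) (hT : h.var .T = T)
    (hs : ∀ v, h.arr .start v = 0) (he : ∀ v, h.arr .last v = 0) :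
    lifetimes.Spec h (9 + T * (n * (n * 109 + 15) + 15)) fun h' =>
      h'.var .row = T * (n * n) ∧
      Recorded T (SeenBefore n h.inp (T * (n * n))) (h'.arr .start) (h'.arr .last) := by
  refine (Spec.seq (b := 3) (Q := fun h' => h' = h.setVar .row 0) (spec_asg (e := const 0) rfl)
    (b' := 6 + T * ((6 + n * ((6 + n * 109) + 9)) + 9)) (Q' := fun h' =>
      h'.var .row = T * (n * n) ∧
      Recorded T (SeenBefore n h.inp (T * (n * n))) (h'.arr .start) (h'.arr .last)) ?_).mono
    (by apply le_of_eq; ring) fun _ _ h => h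
  rintro _ F₁ rfl
  refine (spec_loop (N := T) (b := 6 + n * ((6 + n * 109) + 9)) rfl (by simp [Expr.eval, hT])
    (fun i h' => h'.var .row = i * (n * n) ∧
      Recorded T (SeenBefore n h.inp (i * (n * n))) (h'.arr .start) (h'.arr .last)) ?_ ?_).mono
    (by simp [Expr.size]) fun _ _ h => h
  · refine ⟨by simp, ⟨?_, fun v hv => ?_, fun v hv => ?_⟩⟩
    · rintro i v ⟨-, u, -, h, -⟩
      simp at h
    · exact absurd (hs v) hv
    · exact absurd (he v) hv
  rintro i hi h₂ F₂ hiv hI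
  have hn₂ : h₂.var .n = n := by rw [F₂.var _ rfl, F₁.var _ rfl, hn]
  have hT₂ : h₂.var .T = T := by rw [F₂.var _ rfl, F₁.var _ rfl, hT]
  have hin₂ : h₂.inp = h.inp := F₂.inp.trans F₁.inp
  refine (spec_loop (N := n) (b := 6 + n * 109) rfl (by simp [Expr.eval, hn₂])
    (fun v h' => h'.var .row = (i * n + v) * n ∧
      Recorded T (SeenBefore n h.inp ((i * n + v) * n)) (h'.arr .start) (h'.arr .last)) ?_ ?_).mono
    (by simp [Expr.size]) ?_
  · simpa [mul_assoc] using hI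
  swap
  · intro h₃ _ hI
    rw [← Nat.succ_mul, mul_assoc] at hI
    exact hI
  rintro v hv h₃ F₃ hvv hI
  have hn₃ : h₃.var .n = n := (F₃.var _ rfl).trans hn₂
  have hT₃ : h₃.var .T = T := (F₃.var _ rfl).trans hT₂
  have hi₃ : h₃.var .i = i := (F₃.var _ rfl).trans hiv
  have hin₃ : h₃.inp = h.inp := F₃.inp.trans hin₂
  refine (spec_loop (N := n) (b := 100) rfl (by simp [Expr.eval, hn₃])
    (fun u h' => h'.var .row = (i * n + v) * n + u ∧
      Recorded T (SeenBefore n h.inp ((i * n + v) * n + u)) (h'.arr .start) (h'.arr .last))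
    ?_ ?_).mono (by simp [Expr.size]) ?_
  · simpa using hI
  swap
  · intro h₄ _ hI
    rw [← Nat.succ_mul] at hI
    exact hI
  rintro u hu h₄ F₄ huv ⟨hI1, hI2⟩
  have hT₄ : h₄.var .T = T := (F₄.var _ rfl).trans hT₃
  have hi₄ : h₄.var .i = i := (F₄.var _ rfl).trans hi₃
  have hv₄ : h₄.var .v = v := (F₄.var _ rfl).trans hvv
  have hin₄ : h₄.inp = h.inp := F₄.inp.trans hin₃
  refine spec_of_loopFree rfl (Nat.le_of_ble_eq_true rfl) ?_
  rw [show SeenBefore n h.inp ((i * n + v) * n + (u + 1)) = fun j w =>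
    SeenBefore n h.inp ((i * n + v) * n + u) j w ∨
      (h.inp ((i * n + v) * n + u) ≠ 0 ∧ j = i ∧ w = v) from
    funext₂ fun j w => propext (seenBefore_succ hv hu j w)]
  by_cases h0 : h.inp ((i * n + v) * n + u) = 0
  · simpa [record, run, Expr.eval, hI1, hin₄, h0, add_assoc] using hI2
  · have := hI2.insert (v := v) hi fun j w hE => hE.le hv hu
    refine ⟨by simp [record, run, Expr.eval, hI1, hin₄, h0, add_assoc], ?_⟩
    simp only [ne_eq, h0, not_false_eq_true, true_and]
    convert this using 1
    · funext w
      simp [record, run, Expr.eval, hI1, hin₄, h0, hv₄, hT₄, hi₄]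
    · funext w
      simp [record, run, Expr.eval, hI1, hin₄, h0, hv₄, hi₄]

/-- Compute the square of `n`. -/
def square : Stmt := seq (asg .n2 (const 0)) (rep (var .n) (asg .n2 (add (var .n2) (var .n))))

theorem spec_square {h : Store} {n : ℕ} (hn : h.var .n = n) :
    square.Spec h (6 + n * 10) fun h' => h'.var .n2 = n * n := by
  refine (Spec.seq (b := 3) (Q := fun h' => h' = h.setVar .n2 0) (spec_asg (e := const 0) rfl)
    (b' := 3 + n * 10) (Q' := fun h' => h'.var .n2 = n * n) ?_).mono (by omega) fun _ _ h => h
  rintro _ F₁ rfl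
  refine (spec_rep (N := n) (b := 7) (by simp [Expr.eval, hn]) (fun m h' => h'.var .n2 = m * n)
    (by simp) ?_).mono (by simp [Expr.size]) fun _ _ h => h
  rintro m hm h₂ F₂ hI
  refine spec_asg ?_
  simp [Expr.eval, hI, F₂.var .n rfl, hn, Nat.succ_mul]

/-- Compute a bound for the length of a lifetime, above which its vertex has to be stored. -/
def threshold : Stmt :=
  seq (asg .kc (cond (sub (var .T) (var .k)) (var .k) (var .T)))
    (seq (asg .lc (cond (sub (var .T) (var .l)) (var .l) (var .T)))
      (seq (asg .X (const 0)) (rep (var .kc) (asg .X (add (var .X) (add (var .lc) (const 1)))))))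

/-- Cutting `k` and `ℓ` off at `T` keeps the repeated addition within `O(T)` steps, however large
`k` and `ℓ` are. -/
theorem spec_threshold {h : Store} {T k l : ℕ} (hT : h.var .T = T) (hk : h.var .k = k)
    (hl : h.var .l = l) : threshold.Spec h (40 + T * 12) fun h' =>
      h'.var .X = min k T * (min l T + 1) := by
  have hmin : ∀ m : ℕ, (if T - m ≠ 0 then m else T) = min m T := by
    intro m
    split_ifs <;> omega
  refine (Spec.seq (b := 12) (Q := fun h' => h' = h.setVar .kc (min k T))
    (spec_asg (e := cond (sub (var .T) (var .k)) (var .k) (var .T))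
      (by simp only [Expr.eval, hT, hk, hmin])) (b' := 12 + (3 + (3 + T * 12)))
    (Q' := fun h' => h'.var .X = min k T * (min l T + 1)) ?_).mono (by omega) fun _ _ h => h
  rintro _ F₁ rfl
  refine Spec.seq (b := 12) (Q := fun h' => h' = (h.setVar .kc (min k T)).setVar .lc (min l T))
    (spec_asg (e := cond (sub (var .T) (var .l)) (var .l) (var .T))
      (by simp only [Expr.eval, hT, hl, hmin, Store.setVar_var, reduceCtorEq, if_false])) ?_
  rintro _ F₂ rfl
  refine Spec.seq (b := 3) (Q := fun h' => h' =
    ((h.setVar .kc (min k T)).setVar .lc (min l T)).setVar .X 0) (spec_asg (e := const 0) rfl) ?_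
  rintro _ F₃ rfl
  refine (spec_rep (N := min k T) (b := 9) (by simp [Expr.eval])
    (fun m h' => h'.var .X = m * (min l T + 1)) (by simp) ?_).mono ?_ fun _ _ h => h
  · rintro m hm h₂ F₄ hI
    refine spec_asg ?_
    simp [Expr.eval, hI, F₄.var .lc rfl, Nat.succ_mul]
  · have := Nat.mul_le_mul_right 12 (min_le_right k T)
    simp only [Expr.size]
    omega

/-- The whole program. The answer is stored in `n`. -/
def solve : Stmt :=
  seq square (seq threshold (seq lifetimes (seq sweep
    (asg .n (cond (sub (add (var .t) (var .t)) (rd .val (const 0))) (const 0) (const 1))))))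

end Stmt

/-! ### Correctness and running time -/

theorem index_lt {n T i v u : ℕ} (hi : i < T) (hv : v < n) (hu : u < n) :
    (i * n + v) * n + u < T * (n * n) := by
  have h1 : (i * n + v + 1) * n ≤ (i + 1) * n * n := Nat.mul_le_mul_right n (by rw [Nat.succ_mul]; omega)
  have h2 : (i + 1) * n * n ≤ T * n * n := Nat.mul_le_mul_right _ (Nat.mul_le_mul_right _ hi)
  rw [Nat.succ_mul] at h1
  rw [← mul_assoc]
  omega

/-- If `k` or `l` exceeds `T`, both products are larger than `d`; otherwise they coincide. -/
theorem min_mul_le_iff {k l T d : ℕ} (hk : 1 ≤ k) (hd : d < T) :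
    min k T * (min l T + 1) ≤ d ↔ k * (l + 1) ≤ d := by
  by_cases hkT : k ≤ T
  · by_cases hlT : l ≤ T
    · rw [min_eq_left hkT, min_eq_left hlT]
    · rw [min_eq_left hkT, min_eq_right (by omega)]
      have h1 := Nat.mul_le_mul_right (T + 1) hk
      have h2 := Nat.mul_le_mul_right (l + 1) hk
      constructor <;> intro h <;> omega
  · rw [min_eq_right (by omega)]
    have h1 := Nat.mul_le_mul_left T (show 1 ≤ min l T + 1 by omega)
    have h2 := Nat.mul_le_mul_left k (show 1 ≤ l + 1 by omega)
    constructor <;> intro h <;> omega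

namespace TimelinePVC

variable (I : TimelinePVC)

/-- The initial store of the loop program. -/
noncomputable def store : Store where
  var x := I.initialState.reg x.idx
  arr _ _ := 0
  inp := I.initialState.mem

theorem mem_ne_zero {i u v : ℕ} (hi : i < I.T) (hu : u < I.n) (hv : v < I.n) :
    I.initialState.mem ((i * I.n + u) * I.n + v) ≠ 0 ↔ (I.graph ⟨i, hi⟩).Adj ⟨u, hu⟩ ⟨v, hv⟩ := by
  simp only [initialState, ne_eq, ite_eq_right_iff, one_ne_zero, imp_false, not_not]
  constructor
  · rintro ⟨i', u', v', h, ha⟩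
    obtain ⟨h1, h2, h3⟩ := index_injective hu hv u'.2 v'.2 h
    subst h1 h2 h3
    exact ha
  · exact fun h => ⟨⟨i, hi⟩, ⟨u, hu⟩, ⟨v, hv⟩, rfl, h⟩

theorem mem_eq_zero {m : ℕ} (hm : I.T * (I.n * I.n) ≤ m) : I.initialState.mem m = 0 := by
  simp only [initialState, ite_eq_right_iff, one_ne_zero, imp_false]
  rintro ⟨i, u, v, h, -⟩
  have := index_lt i.2 u.2 v.2
  omega

/-- The data of the dynamic program, if the lifetime of `v` is `[T - s v, e v]`. -/
noncomputable def model (s e : ℕ → ℕ) : Model where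
  n := I.n
  T := I.T
  k := I.k
  l := I.ℓ
  alive i v := I.T - s v < i ∧ i ≤ e v ∧ I.k * (I.ℓ + 1) ≤ e v - (I.T - s v)
  adj i u v := ∃ (hi : i < I.T) (hu : u < I.n) (hv : v < I.n),
    (I.graph ⟨i, hi⟩).Adj ⟨u, hu⟩ ⟨v, hv⟩

/-- The arrays `s` and `e` describe the lifetimes of the vertices. -/
abbrev LifetimesRecorded (s e : ℕ → ℕ) : Prop :=
  Recorded I.T (SeenBefore I.n I.initialState.mem (I.T * (I.n * I.n))) s e

variable {I} {s e : ℕ → ℕ}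

theorem seenBefore_iff {i v : ℕ} :
    SeenBefore I.n I.initialState.mem (I.T * (I.n * I.n)) i v ↔
      ∃ (hi : i < I.T) (hv : v < I.n) (u : Fin I.n), (I.graph ⟨i, hi⟩).Adj ⟨v, hv⟩ u := by
  constructor
  · rintro ⟨hv, u, hu, h, h0⟩
    have hi : i < I.T := by
      by_contra hi
      refine h0 (I.mem_eq_zero ?_)
      have h1 : I.T * I.n * I.n ≤ (i * I.n + v) * I.n := Nat.mul_le_mul_right _
        ((Nat.mul_le_mul_right _ (not_lt.1 hi)).trans (Nat.le_add_right _ _))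
      rw [← mul_assoc]
      omega
    exact ⟨hi, hv, ⟨u, hu⟩, (I.mem_ne_zero hi hv hu).1 h0⟩
  · rintro ⟨hi, hv, u, h⟩
    exact ⟨hv, u, u.2, index_lt hi hv u.2, (I.mem_ne_zero hi hv u.2).2 h⟩

theorem LifetimesRecorded.lifetimes (R : I.LifetimesRecorded s e) :
    (I.model s e).Lifetimes (fun v => I.T - s v) e := by
  have key : ∀ i u v, (I.model s e).adj i u v → I.T - s u ≤ i ∧ i ≤ e u := by
    rintro i u v ⟨hi, hu, hv, h⟩
    have := R.le i u (seenBefore_iff.2 ⟨hi, hu, ⟨v, hv⟩, h⟩)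
    omega
  exact ⟨I.one_le_k, fun i v => Iff.rfl, key,
    fun i u v ⟨hi, hu, hv, h⟩ => key i v u ⟨hi, hv, hu, h.symm⟩⟩

theorem LifetimesRecorded.last_lt (R : I.LifetimesRecorded s e) (v : ℕ) :
    e v < I.T ∨ e v = 0 := by
  by_cases h : e v = 0
  · exact Or.inr h
  · obtain ⟨i, h1, -, h2⟩ := R.last v h
    exact Or.inl (h2 ▸ h1)

/-- A stored vertex has a lifetime of length at least `k(ℓ+1)` within `T` time steps, which forces
`k ≤ T` and `ℓ ≤ T`. -/
theorem LifetimesRecorded.radix_le (R : I.LifetimesRecorded s e) (i j : ℕ) :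
    (I.model s e).radix i j ≤ I.T + 1 := by
  have key : ∀ v, (I.model s e).alive i v → I.k ≤ I.T ∧ I.ℓ ≤ I.T := by
    rintro v ⟨h1, h2, h3⟩
    have h4 := R.last_lt v
    have h5 := Nat.mul_le_mul_left I.k (show 1 ≤ I.ℓ + 1 by omega)
    have h6 := Nat.mul_le_mul_right (I.ℓ + 1) I.one_le_k
    omega
  unfold Model.radix
  split_ifs with h1 h2 h3
  · exact Nat.succ_le_succ (key _ h2).2
  · omega
  · exact Nat.succ_le_succ (key _ h3).1
  · omega

theorem LifetimesRecorded.link (R : I.LifetimesRecorded s e) {h : Store}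
    (hn : h.var .n = I.n) (hT : h.var .T = I.T) (hk : h.var .k = I.k) (hl : h.var .l = I.ℓ)
    (hn2 : h.var .n2 = I.n * I.n) (hX : h.var .X = min I.k I.T * (min I.ℓ I.T + 1))
    (hinp : h.inp = I.initialState.mem) (hs : h.arr .start = s) (he : h.arr .last = e) :
    (I.model s e).Link h where
  n := hn
  T := hT
  k := hk
  l := hl
  n2 := hn2
  adj i u v hi hu hv := by
    rw [hinp]
    exact (I.mem_ne_zero hi hu hv).trans
      ⟨fun h => ⟨hi, hu, hv, h⟩, fun ⟨_, _, _, h⟩ => h⟩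
  alive i v hi hv := by
    rw [hs, he, hX]
    refine and_congr_right fun h1 => and_congr_right fun h2 => ?_
    change i ≤ I.T at hi
    have := R.last_lt v
    exact (min_mul_le_iff I.one_le_k (by omega)).symm

/-- Time `i` belongs to the lifetimes of all vertices stored at boundary `i`, and a vertex is in
every bag between its first and its last edge. -/
theorem LifetimesRecorded.card_alive_le (R : I.LifetimesRecorded s e) (i : ℕ) (A : Finset (Fin I.n))
    (hA : ∀ v ∈ A, (I.model s e).alive i v) :
    A.card ≤ 2 * I.graph.vimw (I.k * (I.ℓ + 1) + 1) := by
  classical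
  rcases A.eq_empty_or_nonempty with rfl | ⟨w, hw⟩
  · simp
  have hlt : ∀ v ∈ A, e v < I.T := fun v hv => by
    have h1 := (hA v hv).1
    have h2 := (hA v hv).2.1
    have := R.last_lt v
    omega
  have hi : i < I.T := (hA w hw).2.1.trans_lt (hlt w hw)
  refine I.graph.card_le_two_mul_vimw (by omega) A ⟨i, hi⟩ (fun v => I.T - s v) (fun v => e v)
    (fun v hv => (hA v hv).1.le) (fun v hv => (hA v hv).2.1) hlt (fun v hv => ?_)
    fun v hv j hj1 hj2 => ?_
  · have h1 := (hA v hv).1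
    have h2 := (hA v hv).2.1
    have h3 := (hA v hv).2.2
    omega
  · have h1 := (hA v hv).1
    have h2 := (hA v hv).2.1
    have := hlt v hv
    obtain ⟨p, hp, hE, hps⟩ := R.start v (by omega)
    obtain ⟨q, hq, hE', hqe⟩ := R.last v (by omega)
    obtain ⟨_, _, x, hx⟩ := seenBefore_iff.1 hE
    obtain ⟨_, _, y, hy⟩ := seenBefore_iff.1 hE'
    rw [TemporalGraph.bag, Finset.mem_filter]
    refine ⟨Finset.mem_univ _, ⟨p, hp⟩, ⟨q, hq⟩, Fin.le_def.2 ?_, Fin.le_def.2 ?_,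
      (SimpleGraph.degree_pos_iff_exists_adj ..).2 ⟨x, hx⟩,
      (SimpleGraph.degree_pos_iff_exists_adj ..).2 ⟨y, hy⟩⟩
    · simp only; omega
    · simp only; omega

/-- Only stored vertices have nontrivial digits, and each contributes the factor `(k+1)(ℓ+1)`;
passing to `ℓ+2` is slack. -/
theorem LifetimesRecorded.states_le (R : I.LifetimesRecorded s e) (i : ℕ) :
    (I.model s e).states i ≤
      ((I.k + 1) * (I.ℓ + 2)) ^ (2 * I.graph.vimw (I.k * (I.ℓ + 1) + 1)) := by
  classical
  have h1 : (I.model s e).states i = ∏ v : Fin I.n, if (I.model s e).alive i v then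
      (I.k + 1) * (I.ℓ + 1) else 1 := by
    rw [Model.states, Finset.prod_range_add, ← Finset.prod_mul_distrib]
    change ∏ v ∈ Finset.range I.n, (I.model s e).radix i v * (I.model s e).radix i (I.n + v) = _
    refine (Finset.prod_range _).trans (Finset.prod_congr rfl fun v _ => ?_)
    have e1 : (I.model s e).radix i v = if (I.model s e).alive i v then I.ℓ + 1 else 1 :=
      if_pos v.2
    have e2 : (I.model s e).radix i (I.n + v) = if (I.model s e).alive i v then I.k + 1 else 1 := by
      rw [Model.radix]
      change (if I.n + v < I.n then _ else if (I.model s e).alive i (I.n + v - I.n) then I.k + 1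
        else 1) = _
      rw [if_neg (by omega), Nat.add_sub_cancel_left]
    rw [e1, e2]
    by_cases ha : (I.model s e).alive i v
    · rw [if_pos ha, if_pos ha, if_pos ha, mul_comm]
    · rw [if_neg ha, if_neg ha, if_neg ha]
  rw [h1, Finset.prod_ite, Finset.prod_const, Finset.prod_const_one, mul_one]
  have hcard := R.card_alive_le i (Finset.univ.filter fun v : Fin I.n => (I.model s e).alive i v)
    fun v hv => (Finset.mem_filter.1 hv).2
  exact (Nat.pow_le_pow_left (Nat.mul_le_mul_left _ (by omega)) _).trans
    (Nat.pow_le_pow_right (by positivity) hcard)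

/-- The covered temporal edges correspond to two ordered pairs each. -/
theorem two_mul_ncard_eq (A : Fin I.n → Fin I.T → Prop) (A' : ℕ → ℕ → Prop)
    (hA : ∀ (v : Fin I.n) (j : Fin I.T), A' j v ↔ A v j) :
    2 * {p ∈ I.graph.temporalEdges | ∃ v ∈ p.1, A v p.2}.ncard =
      ∑ j ∈ Finset.range I.T, (I.model s e).gain j (A' j) := by
  classical
  -- The covered edges at time `j` form a graph whose degree sum is the gain, so the factor 2 is the
  -- handshake lemma.
  let H : Fin I.T → SimpleGraph (Fin I.n) := fun j =>
    { Adj := fun u v => (I.graph j).Adj u v ∧ (A u j ∨ A v j)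
      symm := ⟨fun u v h => ⟨h.1.symm, h.2.symm⟩⟩
      loopless := ⟨fun u h => (I.graph j).loopless.irrefl u h.1⟩ }
  have hgain : ∀ j : Fin I.T, (I.model s e).gain j (A' j) = 2 * (H j).edgeFinset.card := by
    intro j
    rw [← SimpleGraph.sum_degrees_eq_twice_card_edges, Model.gain]
    change ∑ u ∈ Finset.range I.n, ∑ v ∈ Finset.range I.n, _ = _
    refine (Finset.sum_range _).trans (Finset.sum_congr rfl fun u _ => ?_)
    rw [← SimpleGraph.card_neighborFinset_eq_degree, SimpleGraph.neighborFinset_eq_filter,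
      Finset.card_filter]
    refine (Finset.sum_range _).trans (Finset.sum_congr rfl fun v _ => ?_)
    refine if_congr (and_congr ?_ (or_congr (hA u j) (hA v j))) rfl rfl
    exact ⟨fun ⟨_, _, _, h⟩ => h, fun h => ⟨j.2, u.2, v.2, h⟩⟩
  have hset : {p ∈ I.graph.temporalEdges | ∃ v ∈ p.1, A v p.2} =
      ((Finset.univ.filter fun p : Sym2 (Fin I.n) × Fin I.T => p.1 ∈ (H p.2).edgeFinset :
        Finset _) : Set (Sym2 (Fin I.n) × Fin I.T)) := by
    ext ⟨x, j⟩
    induction x with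
    | _ u v => simp [TemporalGraph.temporalEdges, H]
  rw [hset, Set.ncard_coe_finset, Finset.card_eq_sum_card_fiberwise (f := Prod.snd)
    (t := Finset.univ) (fun _ _ => Finset.mem_univ _), Finset.mul_sum, Finset.sum_range]
  refine Finset.sum_congr rfl fun j _ => ?_
  rw [hgain j]
  congr 1
  refine Finset.card_bij (fun p _ => p.1) ?_ ?_ ?_
  · rintro ⟨x, j'⟩ hp
    simp only [Finset.mem_filter, Finset.mem_univ, true_and] at hp
    obtain ⟨h1, rfl⟩ := hp
    exact h1
  · rintro ⟨x, j₁⟩ h₁ ⟨y, j₂⟩ h₂ rfl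
    simp only [Finset.mem_filter, Finset.mem_univ, true_and] at h₁ h₂
    rw [h₁.2, h₂.2]
  · intro x hx
    exact ⟨(x, j), by simpa using hx, rfl⟩

/-- Only start times matter: each interval may be extended to length `ℓ`, cut off at the last time
step, without losing coverage. Intervals with a common start merge, which does not raise the count.
-/
theorem isYes_iff_exists_starts : I.IsYes ↔ ∃ S : ℕ → Finset ℕ, (∀ v, (S v).card ≤ I.k) ∧
    I.t + I.t ≤ ∑ j ∈ Finset.range I.T, (I.model s e).gain j
      fun v => (I.model s e).Covers S v j := by
  classical
  constructor
  · rintro ⟨𝒯, h𝒯, ht⟩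
    refine ⟨fun v => (𝒯.filter fun J => (J.1 : ℕ) = v).image fun J => (J.2.1 : ℕ), fun v => ?_, ?_⟩
    · refine Finset.card_image_le.trans ?_
      by_cases hv : v < I.n
      · refine le_trans (le_of_eq ?_) (h𝒯.card_le ⟨v, hv⟩)
        congr 1
        ext J
        simp [Fin.ext_iff]
      · rw [Finset.filter_false_of_mem]
        · simp
        · rintro J - rfl
          exact hv J.1.2
    · rw [← two_mul, ← two_mul_ncard_eq (fun v j => (I.model s e).Covers
        (fun v => (𝒯.filter fun J => (J.1 : ℕ) = v).image fun J => (J.2.1 : ℕ)) v j) _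
        fun v j => Iff.rfl]
      refine Nat.mul_le_mul_left 2 (ht.trans (Set.ncard_le_ncard ?_ (Set.toFinite _)))
      rintro ⟨x, j⟩ ⟨h1, v, hv, a, b, hab, haj, hjb⟩
      refine ⟨h1, v, hv, a, ?_, haj, ?_⟩
      · exact Finset.mem_image.2 ⟨_, Finset.mem_filter.2 ⟨hab, rfl⟩, rfl⟩
      · have h2 := h𝒯.length_le v a b hab
        have h3 : (j : ℕ) ≤ b := hjb
        change (j : ℕ) ≤ a + I.ℓ
        omega
  · rintro ⟨S, hS, ht⟩
    rw [← two_mul, ← two_mul_ncard_eq (fun v j => (I.model s e).Covers S v j) _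
      fun v j => Iff.rfl] at ht
    refine ⟨Finset.univ.filter fun J => (J.2.1 : ℕ) ∈ S J.1 ∧
      (J.2.2 : ℕ) = min (J.2.1 + I.ℓ) (I.T - 1), ⟨?_, ?_, ?_⟩, ?_⟩
    · intro v a b h
      have h1 := (Finset.mem_filter.1 h).2.2
      have := a.2
      rw [Fin.le_def]
      simp only at h1
      omega
    · intro v a b h
      have h1 := (Finset.mem_filter.1 h).2.2
      simp only at h1
      omega
    · intro v
      refine le_trans (Finset.card_le_card_of_injOn (fun J => (J.2.1 : ℕ)) ?_ ?_) (hS v)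
      · intro J hJ
        simp only [Finset.coe_filter, Finset.mem_filter, Finset.mem_univ, true_and,
          Set.mem_ofPred_eq] at hJ
        obtain ⟨⟨h1, -⟩, rfl⟩ := hJ
        exact h1
      · rintro ⟨v₁, a₁, b₁⟩ h₁ ⟨v₂, a₂, b₂⟩ h₂ h
        simp only [Finset.coe_filter, Finset.mem_filter, Finset.mem_univ, true_and,
          Set.mem_ofPred_eq] at h₁ h₂ h
        obtain ⟨⟨-, h3⟩, h4⟩ := h₁
        obtain ⟨⟨-, h5⟩, h6⟩ := h₂
        simp only [Prod.mk.injEq, Fin.ext_iff]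
        refine ⟨by rw [h4, h6], h, ?_⟩
        rw [h3, h5, h]
    · refine (Nat.le_of_mul_le_mul_left ht two_pos).trans
        (Set.ncard_le_ncard ?_ (Set.toFinite _))
      rintro ⟨x, j⟩ ⟨h1, v, hv, a, ha, haj, hja⟩
      have hj := j.2
      change (j : ℕ) ≤ a + I.ℓ at hja
      simp only at haj
      refine ⟨h1, v, hv, ⟨a, by omega⟩, ⟨min (a + I.ℓ) (I.T - 1), by omega⟩, ?_, haj, ?_⟩
      · rw [Finset.mem_filter]
        exact ⟨Finset.mem_univ _, ha, rfl⟩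
      · rw [Fin.le_def]
        simp only
        omega

open Stmt in
theorem spec_solve (I : TimelinePVC) : solve.Spec I.store
    (2900 * ((I.k + 1) * (I.ℓ + 2)) ^ (4 * I.graph.vimw (I.k * (I.ℓ + 1) + 1)) *
      (I.n + I.T + 1) ^ 3)
    fun h' => (I.IsYes → h'.var .n = 1) ∧ (¬ I.IsYes → h'.var .n = 0) := by
  obtain ⟨s, hs⟩ : ∃ s, s = ((I.k + 1) * (I.ℓ + 2)) ^
    (2 * I.graph.vimw (I.k * (I.ℓ + 1) + 1)) := ⟨_, rfl⟩
  have hs1 : 1 ≤ s := hs ▸ Nat.one_le_pow _ _ (by positivity)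
  -- The exponent 4 arises from pairs of states.
  have hss : ((I.k + 1) * (I.ℓ + 2)) ^ (4 * I.graph.vimw (I.k * (I.ℓ + 1) + 1)) = s * s := by
    rw [hs, ← pow_add]; congr 1; ring
  refine ((spec_square (h := I.store) (n := I.n) rfl).seq (b' := (40 + I.T * 12) +
    ((9 + I.T * (I.n * (I.n * 109 + 15) + 15)) + ((7 + I.T * (140 + I.n * 840 + I.n * I.T * 40 +
      s * (100 + I.n * 300 + s * (1000 * (I.n + 1) ^ 2 + 9)))) + 50)))
    (Q' := fun h' => (I.IsYes → h'.var .n = 1) ∧ (¬ I.IsYes → h'.var .n = 0)) ?_).mono ?_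
    fun _ _ h => h
  swap
  · rw [hss]
    obtain ⟨m, hm⟩ : ∃ m, m = I.n + I.T + 1 := ⟨_, rfl⟩
    obtain ⟨D, hD⟩ : ∃ D, D = s * s * m ^ 3 := ⟨_, rfl⟩
    -- Each monomial of the cost is at most `D`, so it remains to add up the coefficients.
    have key : ∀ x y p q r : ℕ, x ≤ s → y ≤ s → p ≤ m → q ≤ m → r ≤ m →
        x * y * (p * q * r) ≤ D := by
      intro x y p q r hx hy hp hq hr
      rw [hD, show m ^ 3 = m * m * m by ring]
      gcongr
    have m1 : 1 ≤ m := by omega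
    have mn : I.n ≤ m := by omega
    have mT : I.T ≤ m := by omega
    have mn1 : I.n + 1 ≤ m := by omega
    have k0 := key 1 1 1 1 1 hs1 hs1 m1 m1 m1
    have k1 := key 1 1 I.n 1 1 hs1 hs1 mn m1 m1
    have k2 := key 1 1 I.T 1 1 hs1 hs1 mT m1 m1
    have k3 := key 1 1 I.T I.n 1 hs1 hs1 mT mn m1
    have k4 := key 1 1 I.T I.n I.n hs1 hs1 mT mn mn
    have k5 := key 1 1 I.T I.n I.T hs1 hs1 mT mn mT
    have k6 := key s 1 I.T 1 1 le_rfl hs1 mT m1 m1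
    have k7 := key s 1 I.T I.n 1 le_rfl hs1 mT mn m1
    have k8 := key s s I.T 1 1 le_rfl le_rfl mT m1 m1
    have k9 := key s s I.T (I.n + 1) (I.n + 1) le_rfl le_rfl mT mn1 mn1
    rw [← hm, show 2900 * (s * s) * m ^ 3 = 2900 * D by rw [hD]; ring]
    clear hD hss hs hm key
    linarith
  intro h₁ F₁ hn2
  refine (spec_threshold (h := h₁) (T := I.T) (k := I.k) (l := I.ℓ) (F₁.var _ rfl) (F₁.var _ rfl)
    (F₁.var _ rfl)).seq ?_
  intro h₂ F₂ hX
  refine (spec_lifetimes (h := h₂) (n := I.n) (T := I.T) ?_ ?_ ?_ ?_).seq ?_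
  · rw [F₂.var _ rfl, F₁.var _ rfl]; rfl
  · rw [F₂.var _ rfl, F₁.var _ rfl]; rfl
  · rw [F₂.arr _ rfl, F₁.arr _ rfl]; exact fun _ => rfl
  · rw [F₂.arr _ rfl, F₁.arr _ rfl]; exact fun _ => rfl
  rintro h₃ F₃ ⟨hrow, hR⟩
  have hinp : h₂.inp = I.initialState.mem := by rw [F₂.inp, F₁.inp]; rfl
  rw [hinp] at hR
  have R : I.LifetimesRecorded (h₃.arr .start) (h₃.arr .last) := hR
  have L : (I.model (h₃.arr .start) (h₃.arr .last)).Link h₃ := by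
    refine R.link ?_ ?_ ?_ ?_ ?_ ?_ ?_ rfl rfl
    · rw [F₃.var _ rfl, F₂.var _ rfl, F₁.var _ rfl]; rfl
    · rw [F₃.var _ rfl, F₂.var _ rfl, F₁.var _ rfl]; rfl
    · rw [F₃.var _ rfl, F₂.var _ rfl, F₁.var _ rfl]; rfl
    · rw [F₃.var _ rfl, F₂.var _ rfl, F₁.var _ rfl]; rfl
    · rw [F₃.var _ rfl, F₂.var _ rfl, hn2]
    · rw [F₃.var _ rfl, hX]
    · rw [F₃.inp, hinp]
  refine (spec_sweep R.radix_le L hrow ?_ (s := s) fun i => hs ▸ R.states_le i).seq ?_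
  · intro m
    rw [F₃.arr _ rfl, F₂.arr _ rfl, F₁.arr _ rfl]; rfl
  intro h₄ F₄ hval
  have h0 := hval 0 (Finset.prod_pos fun j _ => Model.radix_pos _ _ _)
  have ht : h₄.var .t = I.t := by
    rw [F₄.var _ rfl, F₃.var _ rfl, F₂.var _ rfl, F₁.var _ rfl]; rfl
  refine spec_of_loopFree rfl (Nat.le_of_ble_eq_true rfl) ?_
  have hyes : I.IsYes ↔ I.t + I.t ≤ h₄.arr .val 0 := by
    rw [h0, R.lifetimes.le_value_iff, isYes_iff_exists_starts]
    rfl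
  rw [hyes]
  simp only [run, Expr.eval, Store.setVar_var, if_true, ht]
  constructor
  · intro h
    rw [if_neg (by omega)]
  · intro h
    rw [if_pos (by omega)]

end TimelinePVC

open RAM TimelinePVC in
theorem mainTheorem11 :
    ∃ (P : RAM.Prog) (C c : ℕ), ∀ I : TimelinePVC,
      RAM.DecidesInTime P I.initialState I.IsYes
        (C * ((I.k + 1) * (I.ℓ + 2)) ^ (4 * I.graph.vimw (I.k * (I.ℓ + 1) + 1)) *
          (I.n + I.T + 1) ^ c) := by
  -- Two multiplications put `T·n²`, the length of the input, into register 40, where compiled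
  -- programs expect `base`.
  refine ⟨.seq (mulProg 41 1 0 42 43) (.seq (mulProg 40 41 0 42 43) (Stmt.solve.comp 41)), 3000, 3,
    fun I => ?_⟩
  obtain ⟨s₁, τ₁, e₁, t₁, m₁, v₁, r₁⟩ := exec_mulProg (d := 41) (a := 1) (b := 0) (c := 42) (o := 43)
    (by decide) (by decide) (by decide) (by decide) (by decide) (by decide) (by decide) (by decide)
    (by decide) I.initialState
  obtain ⟨s₂, τ₂, e₂, t₂, m₂, v₂, r₂⟩ := exec_mulProg (d := 40) (a := 41) (b := 0) (c := 42)
    (o := 43) (by decide) (by decide) (by decide) (by decide) (by decide) (by decide) (by decide)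
    (by decide) (by decide) s₁
  have hn : I.initialState.reg 0 = I.n := rfl
  have hT : I.initialState.reg 1 = I.T := rfl
  rw [hT] at t₁
  rw [hT, hn] at v₁
  rw [v₁] at t₂
  rw [v₁, r₁ 0 (by decide) (by decide) (by decide), hn, mul_assoc] at v₂
  have H : Represents (I.T * (I.n * I.n)) s₂ I.store := by
    refine ⟨fun x => ?_, v₂, fun m _ => by rw [m₂, m₁]; rfl, fun m hm => I.mem_eq_zero hm,
      fun A j => ?_⟩
    · have := x.idx_lt
      rw [r₂ _ (by omega) (by omega) (by omega), r₁ _ (by omega) (by omega) (by omega)]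
      rfl
    · rw [m₂, m₁]
      exact I.mem_eq_zero (Nat.le_add_left _ _)
  obtain ⟨s₃, τ₃, e₃, t₃, H₃, -⟩ := Stmt.solve.exec_comp H (d := 41) (by decide)
  obtain ⟨hans, hcost⟩ := spec_solve I
  refine ⟨s₃, _, e₁.seq (e₂.seq e₃), ?_, ?_, ?_⟩
  · have hB : 1 ≤ ((I.k + 1) * (I.ℓ + 2)) ^ (4 * I.graph.vimw (I.k * (I.ℓ + 1) + 1)) :=
      Nat.one_le_pow _ _ (by positivity)
    have h1 : (I.n + I.T + 1) ^ 3 ≤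
        ((I.k + 1) * (I.ℓ + 2)) ^ (4 * I.graph.vimw (I.k * (I.ℓ + 1) + 1)) *
          (I.n + I.T + 1) ^ 3 := Nat.le_mul_of_pos_left _ hB
    -- This bounds the cost of the two multiplications; the difference between 3000 and 2900 absorbs
    -- it.
    have h2 : 10 + 3 * I.T + 3 * (I.T * I.n) ≤ 10 * (I.n + I.T + 1) ^ 3 := by
      nlinarith [Nat.zero_le (I.T * I.n), Nat.zero_le (I.n ^ 3), Nat.zero_le (I.T ^ 3),
        Nat.zero_le (I.n ^ 2 * I.T), Nat.zero_le (I.n * I.T ^ 2), Nat.zero_le (I.n ^ 2),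
        Nat.zero_le (I.T ^ 2)]
    rw [mul_assoc] at hcost ⊢
    omega
  · intro h
    exact (H₃.var .n).trans (hans.1 h)
  · intro h
    exact (H₃.var .n).trans (hans.2 h)
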